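/- Let $G=\mathrm{SL}(2,\mathbb R)$, $K=\mathrm{SO}(2)$, $G_{\mathbb C}=\mathrm{SL}(2,\mathbb C)$, $K_{\mathbb C}=\mathrm{SO}(2,\mathbb C)$, $X_{\mathbb C}=G_{\mathbb C}/K_{\mathbb C}$ with base point $x_o=eK_{\mathbb C}$, and $X=G\cdot x_o\cong G/K$. Put $\mathfrak a=\{\mathrm{diag}(y,-y):y\in\mathbb R\}\cong\mathbb R$, $\Omega=(-\pi/4,\pi/4)\subset\mathfrak a$, and let $\Xi=G\exp(i\Omega)\cdot x_o$ be the complex crown. Let $N_{\mathbb C}$ be the group of upper triangular unipotent matrices in $G_{\mathbb C}$, and let $\log a:\Xi\to\mathfrak a_{\mathbb C}$ be the holomorphic map with $\log a(x_o)=0$ and $z\in N_{\mathbb C}\exp(\log a(z))\cdot x_o$ for $z\in\Xi$. For $\lambda\in\mathfrak a_{\mathbb C}^*$ the spherical function is $\varphi_\lambda(z)=\int_K e^{(\rho+\lambda)(\log a(kz))}\,dk$ ($z\in\Xi$), where $dk$ is the normalized Haar measure of $K$ and $\rho(\mathrm{diag}(y,-y))=y$. Let $P(g\cdot x_o)=\mathrm{tr}(gg^t)$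 for $g\in G_{\mathbb C}$, and $\widehat X_{\mathbb C,2\Omega}=\{z\in X_{\mathbb C}:P(z)\notin(-\infty,-2]\}$. A $G$-domain is a non-empty connected open $G$-invariant subset of $X_{\mathbb C}$. (1) For every $\lambda\in i\mathfrak a^*$ the function $\varphi_\lambda$ is holomorphic on $\Xi$, and $\Xi$ is maximal, with respect to inclusion, among the $G$-domains $U\supseteq X$ for which $\varphi_\lambda|_X$ extends to a holomorphic function on $U$. (2) One has $\Xi\subseteq\widehat X_{\mathbb C,2\Omega}$, and for every $\lambda\in i\mathfrak a^*$ the function $\varphi_\lambda$ extends to a $K_{\mathbb C}$-invariant holomorphic function on $\widehat X_{\mathbb C,2\Omega}$. (3) For every $Y=\mathrm{diag}(y,-y)\in 2\Omega\setminus\overline\Omega$ there is a continuous curve $\gamma:[0,1]\to G$ with $\gamma(0)=\mathbf 1$ such that $\sigma(s)=P(\gamma(s)\exp(iY)\cdot x_o)$ is real and strictly decreasing on $[0,1]$, with $\sigma(0)=P(\exp(iY)\cdot x_o)=2\cos 2y\in(-2,0)$ and $\sigma(1)=-2$. Along this curve, for every $\lambda\in i\mathfrak a^*$, $\varphi_\lambda$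 (that is, every holomorphic extension of $\varphi_\lambda$ from $\Xi$ to $\widehat X_{\mathbb C,2\Omega}$) blows up: $\varphi_\lambda(\gamma(s)\exp(iY)\cdot x_o)$ is real and positive for $s\in[0,1)$ and tends to $+\infty$ as $s\nearrow1$. -/

import Mathlib

open scoped MatrixGroups Topology

noncomputable section

namespace SL2Crown

/-- The inclusion of `G = SL(2, ℝ)` into its universal complexification `G_ℂ = SL(2, ℂ)`. -/
def toC : SL(2, ℝ) →* SL(2, ℂ) :=
  Matrix.SpecialLinearGroup.map (algebraMap ℝ ℂ)

/-- `K_ℂ = SO(2, ℂ)`, the complex matrices `k` of determinant one with `k kᵗ = 1`. -/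
def KC : Subgroup SL(2, ℂ) where
  carrier := {k | k.1 * k.1.transpose = 1}
  one_mem' := by simp
  mul_mem' := by
    intro a b ha hb
    simp only [Set.mem_ofPred_eq] at ha hb ⊢
    calc (a * b).1 * (a * b).1.transpose
        = a.1 * (b.1 * b.1.transpose) * a.1.transpose := by
          simp [Matrix.transpose_mul, Matrix.mul_assoc]
      _ = 1 := by rw [hb, Matrix.mul_one, ha]
  inv_mem' := by
    intro a ha
    simp only [Set.mem_ofPred_eq] at ha ⊢
    have h1 : (a⁻¹).1 * a.1 = 1 := by
      rw [← Matrix.SpecialLinearGroup.coe_mul]; simp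
    calc (a⁻¹).1 * (a⁻¹).1.transpose
        = (a⁻¹).1 * (a.1 * a.1.transpose) * (a⁻¹).1.transpose := by rw [ha, Matrix.mul_one]
      _ = ((a⁻¹).1 * a.1) * ((a⁻¹).1 * a.1).transpose := by
          simp only [Matrix.transpose_mul, Matrix.mul_assoc]
      _ = 1 := by rw [h1]; simp

/-- The homogeneous space `X_ℂ = SL(2, ℂ) / SO(2, ℂ)`, with its quotient topology and the left
translation action of `SL(2, ℂ)`. -/
abbrev XC : Type := SL(2, ℂ) ⧸ KC

/-- The base point `x_o = e K_ℂ`. -/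
def basePt : XC := ((1 : SL(2, ℂ)) : XC)

/-- The Riemannian symmetric space `X = G / K`, realised as the orbit `G · x_o` in `X_ℂ`. -/
def realX : Set XC := Set.range fun g : SL(2, ℝ) => toC g • basePt

/-- The symmetric matrix `z zᵗ` attached to the point `z · x_o` of `X_ℂ`. -/
def symMat : XC → Matrix (Fin 2) (Fin 2) ℂ :=
  Quotient.lift (fun z : SL(2, ℂ) => z.1 * z.1.transpose) (by
    intro a b hab
    have h : a⁻¹ * b ∈ KC := QuotientGroup.leftRel_apply.mp hab
    have h' : (a⁻¹ * b).1 * (a⁻¹ * b).1.transpose = 1 := h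
    have hb : b.1 = a.1 * (a⁻¹ * b).1 := by
      rw [← Matrix.SpecialLinearGroup.coe_mul]; simp
    change a.1 * a.1.transpose = b.1 * b.1.transpose
    rw [hb, Matrix.transpose_mul, Matrix.mul_assoc, ← Matrix.mul_assoc _ _ a.1.transpose, h',
      Matrix.one_mul])

/-- The elementary spherical function `P (z · x_o) = tr (z zᵗ)` on `X_ℂ`. -/
def P (z : XC) : ℂ := (symMat z).trace

/-- `exp (diag (w, -w))`, where `a_ℂ` is identified with `ℂ` through `w ↦ diag (w, -w)`. -/
def expA (w : ℂ) : SL(2, ℂ) :=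
  ⟨!![Complex.exp w, 0; 0, Complex.exp (-w)], by
    rw [Matrix.det_fin_two_of, ← Complex.exp_add]; simp⟩

/-- The element `(1, x; 0, 1)` of `N_ℂ`. -/
def unip (x : ℂ) : SL(2, ℂ) := ⟨!![1, x; 0, 1], by simp [Matrix.det_fin_two_of]⟩

/-- The rotation by the angle `θ`, an element of `K = SO(2)`. -/
def rot (θ : ℝ) : SL(2, ℝ) :=
  ⟨!![Real.cos θ, -Real.sin θ; Real.sin θ, Real.cos θ], by
    rw [Matrix.det_fin_two_of]; nlinarith [Real.sin_sq_add_cos_sq θ]⟩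

/-- `Ω`, with `a` identified with `ℝ` through `y ↦ diag (y, -y)`: the spectrum `{0, 2 y, -2 y}` of
`ad (diag (y, -y))` has to lie in `(-π/2, π/2)`. -/
def Omega : Set ℝ := Set.Ioo (-(Real.pi / 4)) (Real.pi / 4)

/-- `2 Ω`. -/
def twoOmega : Set ℝ := (fun y : ℝ => 2 * y) '' Omega

/-- The point `exp (i Y) · x_o` for `Y = diag (y, -y)`. -/
def expI (y : ℝ) : XC := expA (y * Complex.I) • basePt

/-- The complex crown `Ξ = G exp (i Ω) · x_o`. -/
def crown : Set XC := {z | ∃ g : SL(2, ℝ), ∃ y ∈ Omega, z = toC g • expI y}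

/-- A `G`-domain in `X_ℂ`: a non-empty, connected, open, `G`-invariant subset. -/
structure IsGDomain (U : Set XC) : Prop where
  isOpen : IsOpen U
  isConnected : IsConnected U
  invariant : ∀ g : SL(2, ℝ), ∀ z ∈ U, toC g • z ∈ U

/-- `f` is holomorphic on the open subset `U` of the complex homogeneous space `X_ℂ`: the pullback
of `f` to the closed complex submanifold `SL(2, ℂ)` of the space `ℂ⁴` of complex `2 × 2` matrices
is holomorphic, i.e. near each point over `U` it is the restriction to `SL(2, ℂ)` of a
holomorphic function on an open subset of `ℂ⁴`. -/
def HolomorphicOn (f : XC → ℂ) (U : Set XC) : Prop :=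
  ∀ g : SL(2, ℂ), (g : XC) ∈ U →
    ∃ F : (Fin 2 → Fin 2 → ℂ) → ℂ,
      AnalyticAt ℂ F (fun i j => g.1 i j) ∧
      ∀ᶠ h : SL(2, ℂ) in 𝓝 g, f (h : XC) = F (fun i j => h.1 i j)

/-- `log a (z)`, as an element of `a_ℂ = ℂ`, for the Iwasawa projection `a : Ξ → A_ℂ`: if
`z = n diag (t, 1 / t) · x_o` with `n` in `N_ℂ`, the lower right entry of the symmetric matrix of
`z` is `t⁻²`, and on `Ξ` it has positive real part. The facts proved below show that this is the
holomorphic, `N`-invariant function on `Ξ` with `log a (x_o) = 0` and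
`z ∈ N_ℂ exp (log a (z)) · x_o`. -/
def logA (z : XC) : ℂ := -(1 / 2) * Complex.log (symMat z 1 1)

/-- The spherical function `φ_λ (z) = ∫_K a (k z)^(ρ + λ) dk` on `Ξ`, with `dk` the normalized Haar
measure of `K = SO(2)`. A linear form `λ` on `a_ℂ` is identified with the complex number `lam` such
that `λ (diag (w, -w)) = lam * w`; in this way `ρ` corresponds to `1`, and the elements of `i a^*`
to the purely imaginary numbers. -/
def spherical (lam : ℂ) (z : XC) : ℂ :=
  (2 * Real.pi : ℂ)⁻¹ *
    ∫ θ in (0 : ℝ)..(2 * Real.pi), Complex.exp ((1 + lam) * logA (toC (rot θ) • z))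

/-- `φ_λ` extends holomorphically from `X` to the `G`-domain `U` that contains `X`. -/
def IsExtensionDomain (lam : ℂ) (U : Set XC) : Prop :=
  IsGDomain U ∧ realX ⊆ U ∧
    ∃ F : XC → ℂ, HolomorphicOn F U ∧ Set.EqOn F (spherical lam) realX

/-- The `K_ℂ`-invariant domain `X̂_{ℂ, 2Ω}`, the set of all `z` in `X_ℂ` with `P z` not in
`(-∞, -2]`. -/
def XHat : Set XC := {z | ¬ ∃ t : ℝ, t ≤ -2 ∧ P z = (t : ℂ)}

theorem coe_expA (w : ℂ) :
    (expA w).1 = NormedSpace.exp (Matrix.diagonal ![w, -w]) := by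
  rw [Matrix.exp_diagonal]
  ext i j
  fin_cases i <;> fin_cases j <;>
    simp [expA, Pi.exp_def, ← Complex.exp_eq_exp_ℂ]

theorem coe_expA' (w : ℂ) : (expA w).1 = !![Complex.exp w, 0; 0, Complex.exp (-w)] := rfl

theorem coe_unip (x : ℂ) : (unip x).1 = !![1, x; 0, 1] := rfl

theorem symMat_mk (g : SL(2, ℂ)) : symMat (g : XC) = g.1 * g.1.transpose := rfl

theorem smul_mk (g h : SL(2, ℂ)) : g • (h : XC) = ((g * h : SL(2, ℂ)) : XC) := rfl

theorem re_symMat_pos {z : XC} (hz : z ∈ crown) : 0 < (symMat z 1 1).re := by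
  obtain ⟨g, y, hy, rfl⟩ := hz
  have hval : (symMat (toC g • expI y) 1 1).re
      = Real.cos (2 * y) * (g.1 1 0 ^ 2 + g.1 1 1 ^ 2) := by
    have e1 : Complex.exp (y * Complex.I) = Real.cos y + Real.sin y * Complex.I := by
      rw [Complex.exp_mul_I]; simp
    have e2 : Complex.exp (-(y * Complex.I)) = Real.cos y - Real.sin y * Complex.I := by
      rw [← neg_mul, Complex.exp_mul_I]; simp [sub_eq_add_neg]
    rw [expI, basePt, smul_mk, smul_mk, symMat_mk]
    rw [mul_one, Matrix.SpecialLinearGroup.coe_mul, coe_expA', e1, e2]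
    simp [toC, Matrix.mul_apply, Fin.sum_univ_two, -Complex.ofReal_cos, -Complex.ofReal_sin]
    rw [Real.cos_two_mul']
    ring
  rw [hval]
  have hc : 0 < Real.cos (2 * y) :=
    Real.cos_pos_of_mem_Ioo ⟨by linarith [hy.1], by linarith [hy.2]⟩
  refine mul_pos hc ?_
  have hdet := g.2
  rw [Matrix.det_fin_two] at hdet
  by_contra hcon
  have h0 : g.1 1 0 = 0 := by nlinarith [sq_nonneg (g.1 1 0), sq_nonneg (g.1 1 1)]
  have h1 : g.1 1 1 = 0 := by nlinarith [sq_nonneg (g.1 1 0), sq_nonneg (g.1 1 1)]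
  rw [h0, h1] at hdet
  simp at hdet

theorem logA_basePt : logA basePt = 0 := by
  simp [logA, basePt, symMat_mk]

theorem logA_unip_smul (x : ℂ) (z : XC) : logA (unip x • z) = logA z := by
  obtain ⟨g, rfl⟩ := QuotientGroup.mk_surjective z
  rw [logA, logA, smul_mk, symMat_mk, symMat_mk]
  rw [Matrix.SpecialLinearGroup.coe_mul, coe_unip]
  simp [Matrix.mul_apply, Matrix.vecMul, dotProduct, Fin.sum_univ_two]

theorem iwasawa {z : XC} (hz : z ∈ crown) :
    ∃ x : ℂ, z = unip x • expA (logA z) • basePt := by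
  have hne : symMat z 1 1 ≠ 0 := by
    intro h
    have := re_symMat_pos hz
    simp [h] at this
  obtain ⟨g, rfl⟩ := QuotientGroup.mk_surjective z
  set L := logA (g : XC) with hL
  have hs : Complex.exp L * Complex.exp L * symMat (g : XC) 1 1 = 1 := by
    rw [← Complex.exp_add, hL, logA]
    have : -(1 / 2) * Complex.log (symMat (g : XC) 1 1)
        + -(1 / 2) * Complex.log (symMat (g : XC) 1 1)
        = -Complex.log (symMat (g : XC) 1 1) := by ring
    rw [this, Complex.exp_neg, Complex.exp_log hne, inv_mul_cancel₀ hne]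
  have hE : Complex.exp (-L) * Complex.exp L = 1 := by rw [← Complex.exp_add]; simp
  refine ⟨symMat (g : XC) 0 1 / symMat (g : XC) 1 1, ?_⟩
  rw [basePt, smul_mk, smul_mk, mul_one, eq_comm, QuotientGroup.eq]
  set x := symMat (g : XC) 0 1 / symMat (g : XC) 1 1 with hx
  have hdet := g.2
  rw [Matrix.det_fin_two] at hdet
  have hS11 : symMat (g : XC) 1 1 = g.1 1 0 ^ 2 + g.1 1 1 ^ 2 := by
    simp [symMat_mk, Matrix.mul_apply, Fin.sum_univ_two]; ring
  have hS01 : symMat (g : XC) 0 1 = g.1 0 0 * g.1 1 0 + g.1 0 1 * g.1 1 1 := by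
    simp [symMat_mk, Matrix.mul_apply, Fin.sum_univ_two]
  have hxs : x * (g.1 1 0 ^ 2 + g.1 1 1 ^ 2) = g.1 0 0 * g.1 1 0 + g.1 0 1 * g.1 1 1 := by
    rw [← hS11, ← hS01, hx, div_mul_cancel₀ _ hne]
  rw [hS11] at hs
  rw [hS11] at hne
  change ((unip x * expA L)⁻¹ * g).1 * ((unip x * expA L)⁻¹ * g).1.transpose = 1
  have hcoe : ((unip x * expA L)⁻¹ * g).1 =
      !![Complex.exp (-L) * (g.1 0 0 - x * g.1 1 0), Complex.exp (-L) * (g.1 0 1 - x * g.1 1 1);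
        Complex.exp L * g.1 1 0, Complex.exp L * g.1 1 1] := by
    rw [Matrix.SpecialLinearGroup.coe_mul, Matrix.SpecialLinearGroup.coe_inv,
      Matrix.SpecialLinearGroup.coe_mul, coe_unip, coe_expA']
    ext i j
    fin_cases i <;> fin_cases j <;>
      simp [Matrix.adjugate_fin_two, Matrix.mul_apply, Fin.sum_univ_two] <;> ring
  rw [hcoe]
  generalize Complex.exp L = E at *
  generalize Complex.exp (-L) = E' at *
  generalize g.1 0 0 = a at *
  generalize g.1 0 1 = b at *
  generalize g.1 1 0 = c at *
  generalize g.1 1 1 = d at *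
  have h1 : (a - x * c) * c + (b - x * d) * d = 0 := by linear_combination -hxs
  have h2 : (a - x * c) * d - (b - x * d) * c = 1 := by linear_combination hdet
  have h3 : ((a - x * c) ^ 2 + (b - x * d) ^ 2) * (c ^ 2 + d ^ 2) = 1 := by
    linear_combination ((a - x * c) * c + (b - x * d) * d) * h1
      + ((a - x * c) * d - (b - x * d) * c + 1) * h2
  have h4 : E' * E' = c ^ 2 + d ^ 2 := by
    linear_combination (-E' * E') * hs + (E' * E + 1) * (c ^ 2 + d ^ 2) * hE
  ext i j
  fin_cases i <;> fin_cases j <;> simp [Matrix.mul_apply, Fin.sum_univ_two]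
  · linear_combination ((a - x * c) ^ 2 + (b - x * d) ^ 2) * h4 + h3
  · linear_combination E' * E * h1
  · linear_combination E' * E * h1
  · linear_combination hs

theorem logA_holomorphicOn : HolomorphicOn logA crown := by
  intro g hg
  refine ⟨fun M => -(1 / 2) * Complex.log (M 1 0 * M 1 0 + M 1 1 * M 1 1), ?_, ?_⟩
  · have hpos := re_symMat_pos hg
    have hS : symMat (g : XC) 1 1 = g.1 1 0 * g.1 1 0 + g.1 1 1 * g.1 1 1 := by
      simp [symMat_mk, Matrix.mul_apply, Fin.sum_univ_two]
    rw [hS] at hpos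
    have hcoord : ∀ i j : Fin 2, AnalyticAt ℂ (fun M : Fin 2 → Fin 2 → ℂ => M i j)
        (fun i j => g.1 i j) := fun i j =>
      ((ContinuousLinearMap.proj (R := ℂ) (φ := fun _ : Fin 2 => ℂ) j).comp
        (ContinuousLinearMap.proj (R := ℂ) (φ := fun _ : Fin 2 => Fin 2 → ℂ) i)).analyticAt _
    refine analyticAt_const.mul (AnalyticAt.clog ?_ (Or.inl hpos))
    exact ((hcoord 1 0).mul (hcoord 1 0)).add ((hcoord 1 1).mul (hcoord 1 1))
  · refine Filter.Eventually.of_forall fun h => ?_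
    rw [logA, symMat_mk]
    simp [Matrix.mul_apply, Fin.sum_univ_two]

end SL2Crown

end

namespace SL2Crown

open MeasureTheory Set Filter

/-- Holomorphic dependence on a parameter of an integral with a locally uniform integrable
bound. -/
theorem analyticAt_integral_of_dominated {α : Type*} [MeasurableSpace α] {ν : Measure α}
    {f : ℂ → α → ℂ} {z₀ : ℂ} {r : ℝ} (hr : 0 < r) {bound : α → ℝ}
    (hmeas : ∀ z ∈ Metric.ball z₀ r, AEStronglyMeasurable (f z) ν)
    (hdiff : ∀ᵐ t ∂ν, DifferentiableOn ℂ (fun z => f z t) (Metric.ball z₀ r))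
    (hbound : ∀ᵐ t ∂ν, ∀ z ∈ Metric.ball z₀ r, ‖f z t‖ ≤ bound t)
    (hint : Integrable bound ν) :
    AnalyticAt ℂ (fun z => ∫ t, f z t ∂ν) z₀ := by
  have key : DifferentiableOn ℂ (fun z => ∫ t, f z t ∂ν) (Metric.ball z₀ r) := by
    intro w hw
    obtain ⟨ε, hε, hsub⟩ := Metric.isOpen_iff.1 Metric.isOpen_ball w hw
    have hε2 : 0 < ε / 2 := by positivity
    have hmem : ∀ z ∈ Metric.ball w (ε / 2), Metric.closedBall z (ε / 4) ⊆ Metric.ball z₀ r := by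
      intro z hz x hx
      apply hsub
      rw [Metric.mem_ball] at hz ⊢
      rw [Metric.mem_closedBall] at hx
      linarith [dist_triangle x z w]
    have hF' : AEStronglyMeasurable (fun t => deriv (fun z => f z t) w) ν := by
      have hlim : Tendsto (fun n : ℕ => w + ((ε / 2 / (n + 1) : ℝ) : ℂ)) atTop (𝓝[≠] w) := by
        refine tendsto_nhdsWithin_iff.2 ⟨?_, Eventually.of_forall fun n => ?_⟩
        · have h : Tendsto (fun n : ℕ => ε / 2 / ((n : ℝ) + 1)) atTop (𝓝 0) :=
            tendsto_const_div_atTop_nhds_zero_nat (ε / 2) |>.comp (tendsto_add_atTop_nat 1) |>.congr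
              (by intro n; simp)
          have h2 := (Complex.continuous_ofReal.tendsto 0).comp h
          simpa using h2.const_add w
        · have : ε / 2 / ((n : ℝ) + 1) ≠ 0 := by positivity
          simpa only [mem_compl_iff, mem_singleton_iff, add_eq_left, Complex.ofReal_eq_zero] using this
      refine aestronglyMeasurable_of_tendsto_ae atTop
        (f := fun (n : ℕ) t => slope (fun z => f z t) w (w + ((ε / 2 / (n + 1) : ℝ) : ℂ))) ?_ ?_
      · intro n
        have h1 : w + ((ε / 2 / (n + 1) : ℝ) : ℂ) ∈ Metric.ball z₀ r := by
          apply hsub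
          rw [Metric.mem_ball, dist_eq_norm, add_sub_cancel_left, Complex.norm_real,
            Real.norm_of_nonneg (by positivity)]
          have : ε / 2 / ((n : ℝ) + 1) ≤ ε / 2 :=
            div_le_self hε2.le (by linarith [n.cast_nonneg (α := ℝ)])
          linarith
        simp only [slope_def_field, div_eq_mul_inv]
        exact ((hmeas _ h1).sub (hmeas _ hw)).mul_const _
      · filter_upwards [hdiff] with t ht
        have := ((ht.differentiableAt (Metric.isOpen_ball.mem_nhds hw)).hasDerivAt)
        exact (hasDerivAt_iff_tendsto_slope.1 this).comp hlim
    have := hasDerivAt_integral_of_dominated_loc_of_deriv_le (μ := ν) (𝕜 := ℂ)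
      (F := f) (F' := fun z t => deriv (fun z => f z t) z) (x₀ := w)
      (bound := fun t => bound t / (ε / 4)) (Metric.ball_mem_nhds w hε2)
      (by filter_upwards [Metric.isOpen_ball.mem_nhds hw] with z hz using hmeas z hz)
      (hint.mono' (hmeas w hw) (by filter_upwards [hbound] with t ht using ht w hw)) hF'
      (by
        filter_upwards [hbound, hdiff] with t ht hd z hz
        refine Complex.norm_deriv_le_of_forall_mem_sphere_norm_le (by positivity) ?_ ?_
        · refine (hd.mono ?_).diffContOnCl
          exact closure_ball z (by positivity : ε / 4 ≠ 0) ▸ hmem z hz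
        · intro x hx
          exact ht x (hmem z hz (Metric.sphere_subset_closedBall hx)))
      (hint.div_const _)
      (by
        filter_upwards [hdiff] with t hd z hz
        exact (hd.differentiableAt (Metric.isOpen_ball.mem_nhds
          (hmem z hz (Metric.mem_closedBall_self (by positivity))))).hasDerivAt)
    exact this.2.differentiableAt.differentiableWithinAt
  exact key.analyticAt (Metric.ball_mem_nhds _ hr)

theorem integrableOn_cpow_mul_exp_neg_mul {a : ℂ} {r : ℝ} (ha : 0 < a.re) (hr : 0 < r) :
    IntegrableOn (fun t : ℝ => (t : ℂ) ^ (a - 1) * Complex.exp (-(r * t))) (Ioi 0) := by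
  by_contra h
  have h1 := Complex.integral_cpow_mul_exp_neg_mul_Ioi ha hr
  rw [integral_undef h] at h1
  refine mul_ne_zero ?_ (Complex.Gamma_ne_zero_of_re_pos ha) h1.symm
  rw [Complex.cpow_ne_zero_iff]
  left
  simpa using hr.ne'

theorem norm_cpow_mul_exp {a : ℂ} {r t : ℝ} (ht : 0 < t) :
    ‖(t : ℂ) ^ (a - 1) * Complex.exp (-(r * t))‖ = t ^ (a.re - 1) * Real.exp (-(r * t)) := by
  rw [norm_mul, Complex.norm_cpow_eq_rpow_re_of_pos ht, Complex.norm_exp]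
  simp

/-- A beta integral over the half line. -/
theorem integral_cpow_mul_one_div_pow {α : ℂ} {m : ℕ} {s : ℝ} (hs : 0 < s) (hα : 0 < α.re)
    (hm : α.re < m) :
    ∫ t in Ioi (0 : ℝ), (t : ℂ) ^ (α - 1) * (1 / (s + t : ℂ)) ^ m =
      (1 / s : ℂ) ^ ((m : ℂ) - α) * Complex.Gamma α * Complex.Gamma (m - α) / Complex.Gamma m := by
  have hm0 : (0 : ℝ) < m := hα.trans hm
  have hmre : 0 < (m : ℂ).re := by simpa using hm0
  have hmα : 0 < ((m : ℂ) - α).re := by simpa using hm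
  set g : ℝ → ℝ → ℂ := fun t r =>
    (t : ℂ) ^ (α - 1) * ((r : ℂ) ^ ((m : ℂ) - 1) * Complex.exp (-((s + t : ℝ) * r))) with hg
  have hg' : ∀ t r, g t r = ((r : ℂ) ^ ((m : ℂ) - 1) * Complex.exp (-(s * r))) *
      ((t : ℂ) ^ (α - 1) * Complex.exp (-(r * t))) := by
    intro t r
    have : Complex.exp (-((s + t : ℝ) * r)) = Complex.exp (-(s * r)) * Complex.exp (-(r * t)) := by
      rw [← Complex.exp_add]; congr 1; push_cast; ring
    rw [hg]; simp only; rw [this]; ring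
  have hcp : ∀ r : ℝ, 0 < r → (r : ℂ) ^ ((m : ℂ) - 1) * (1 / r : ℂ) ^ α
      = (r : ℂ) ^ ((m : ℂ) - α - 1) := by
    intro r hr
    have hr' : (r : ℂ) ≠ 0 := by exact_mod_cast hr.ne'
    rw [one_div, Complex.inv_cpow _ _ (by
      rw [Complex.arg_ofReal_of_nonneg hr.le]; exact Real.pi_pos.ne),
      ← Complex.cpow_neg, ← Complex.cpow_add _ _ hr']
    congr 1; ring
  have hmeas : AEStronglyMeasurable (Function.uncurry g)
      ((volume.restrict (Ioi 0)).prod (volume.restrict (Ioi 0))) := by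
    apply Measurable.aestronglyMeasurable
    rw [hg]
    simp only [Function.uncurry_def]
    fun_prop
  have hint : Integrable (Function.uncurry g)
      ((volume.restrict (Ioi 0)).prod (volume.restrict (Ioi 0))) := by
    rw [integrable_prod_iff' hmeas]
    constructor
    · filter_upwards [ae_restrict_mem measurableSet_Ioi] with r hr
      simp only [Function.uncurry_apply_pair, hg']
      exact (integrableOn_cpow_mul_exp_neg_mul hα hr).const_mul _
    · have h1 := (integrableOn_cpow_mul_exp_neg_mul hmα hs).norm.mul_const (Real.Gamma α.re)
      refine h1.congr ?_
      filter_upwards [ae_restrict_mem measurableSet_Ioi] with r hr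
      simp only [Function.uncurry_apply_pair, hg', norm_mul _ (_ * _ : ℂ)]
      rw [integral_const_mul, norm_cpow_mul_exp hr, norm_cpow_mul_exp hr]
      rw [setIntegral_congr_fun (g := fun t : ℝ => t ^ (α.re - 1) * Real.exp (-(r * t)))
        measurableSet_Ioi (fun t ht => norm_cpow_mul_exp ht),
        Real.integral_rpow_mul_exp_neg_mul_Ioi hα hr]
      have : r ^ (((m : ℂ) - α).re - 1) = r ^ ((m : ℂ).re - 1) * (1 / r) ^ α.re := by
        rw [one_div, Real.inv_rpow hr.le, ← Real.rpow_neg hr.le, ← Real.rpow_add hr]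
        congr 1
        simp; ring
      rw [this]; ring
  have hswap := integral_integral_swap hint
  have hL : ∀ t ∈ Ioi (0 : ℝ), ∫ r in Ioi (0 : ℝ), g t r =
      ((t : ℂ) ^ (α - 1) * (1 / (s + t : ℂ)) ^ m) * Complex.Gamma m := by
    intro t ht
    have hst : 0 < s + t := add_pos hs ht
    rw [hg]; simp only
    rw [integral_const_mul, Complex.integral_cpow_mul_exp_neg_mul_Ioi hmre hst,
      Complex.cpow_natCast]
    push_cast; ring
  have hR : ∀ r ∈ Ioi (0 : ℝ), ∫ t in Ioi (0 : ℝ), g t r =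
      ((r : ℂ) ^ ((m : ℂ) - α - 1) * Complex.exp (-(s * r))) * Complex.Gamma α := by
    intro r hr
    simp only [hg']
    rw [integral_const_mul, Complex.integral_cpow_mul_exp_neg_mul_Ioi hα hr, ← hcp r hr]
    ring
  rw [setIntegral_congr_fun measurableSet_Ioi hL, setIntegral_congr_fun measurableSet_Ioi hR,
    integral_mul_const, integral_mul_const,
    Complex.integral_cpow_mul_exp_neg_mul_Ioi hmα hs] at hswap
  rw [eq_div_iff (Complex.Gamma_ne_zero_of_re_pos hmre), hswap]
  ring

theorem integrableOn_rpow_neg_half_div {δ : ℝ} (hδ : 0 < δ) :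
    IntegrableOn (fun t : ℝ => t ^ (-(1 / 2) : ℝ) * (1 / (δ + t))) (Ioi 0) := by
  have hre : ((1 / 2 : ℂ)).re = 1 / 2 := by norm_num
  have h : IntegrableOn (fun t : ℝ => (t : ℂ) ^ ((1 / 2 : ℂ) - 1) * (1 / (δ + t : ℂ)) ^ 1)
      (Ioi 0) := by
    by_contra h
    have h1 := integral_cpow_mul_one_div_pow (α := 1 / 2) (m := 1) hδ (by norm_num) (by norm_num)
    rw [integral_undef h] at h1
    refine div_ne_zero (mul_ne_zero (mul_ne_zero ?_ ?_) ?_) ?_ h1.symm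
    · rw [Complex.cpow_ne_zero_iff]
      left
      simpa using hδ.ne'
    all_goals exact Complex.Gamma_ne_zero_of_re_pos (by norm_num)
  refine h.norm.congr ?_
  filter_upwards [ae_restrict_mem measurableSet_Ioi] with t ht
  have ht' : 0 < δ + t := add_pos hδ ht
  rw [norm_mul, Complex.norm_cpow_eq_rpow_re_of_pos ht, pow_one, norm_div, norm_one,
    ← Complex.ofReal_add, Complex.norm_real, Real.norm_of_nonneg ht'.le]
  norm_num

theorem norm_cpow_neg_of_re_eq {μ : ℂ} (hμ : μ.re = 1 / 2) {t : ℝ} (ht : 0 < t) :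
    ‖(t : ℂ) ^ (-μ)‖ = t ^ (-(1 / 2) : ℝ) := by
  rw [Complex.norm_cpow_eq_rpow_re_of_pos ht, Complex.neg_re, hμ]

theorem norm_one_div_add_le {s : ℂ} {δ t : ℝ} (hδ : 0 < δ) (hs : δ ≤ s.re) (ht : 0 < t) :
    ‖1 / (s + t)‖ ≤ 1 / (δ + t) := by
  rw [norm_div, norm_one]
  apply one_div_le_one_div_of_le (by linarith)
  calc δ + t ≤ (s + t).re := by simpa using hs
    _ ≤ _ := Complex.re_le_norm _

/-- The powers of exponent `-μ`, with `Re μ = 1 / 2`, as superpositions of resolvents. -/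
theorem integral_cpow_neg_mul_one_div_add {μ s : ℂ} (hμ : μ.re = 1 / 2) (hs : 0 < s.re) :
    ∫ t in Ioi (0 : ℝ), (t : ℂ) ^ (-μ) * (1 / (s + t)) =
      Real.pi / Complex.sin (Real.pi * μ) * s ^ (-μ) := by
  set U : Set ℂ := {z | 0 < z.re} with hU
  have hL : AnalyticOnNhd ℂ (fun s : ℂ => ∫ t in Ioi (0 : ℝ), (t : ℂ) ^ (-μ) * (1 / (s + t))) U := by
    intro z hz
    have hz : 0 < z.re := hz
    have hre : ∀ w ∈ Metric.ball z (z.re / 2), z.re / 2 ≤ w.re := by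
      intro w hw
      have := (Complex.abs_re_le_norm (w - z)).trans_lt (mem_ball_iff_norm.1 hw)
      rw [abs_lt, Complex.sub_re] at this
      linarith
    refine analyticAt_integral_of_dominated (half_pos hz) (fun w hw => ?_) ?_ ?_
      (integrableOn_rpow_neg_half_div (half_pos hz))
    · apply Measurable.aestronglyMeasurable
      fun_prop
    · filter_upwards [ae_restrict_mem measurableSet_Ioi] with t ht w hw
      have hne : w + t ≠ 0 := by
        intro h
        have := congrArg Complex.re h
        simp at this
        linarith [hre w hw, mem_Ioi.1 ht]
      have : DifferentiableAt ℂ (fun w : ℂ => (t : ℂ) ^ (-μ) * (1 / (w + t))) w := by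
        refine (differentiableAt_const _).mul ((differentiableAt_const _).div ?_ hne)
        fun_prop
      exact this.differentiableWithinAt
    · filter_upwards [ae_restrict_mem measurableSet_Ioi] with t ht w hw
      rw [norm_mul, norm_cpow_neg_of_re_eq hμ ht]
      have := norm_one_div_add_le (half_pos hz) (hre w hw) ht
      gcongr
      exact Real.rpow_nonneg (le_of_lt ht) _
  have hR : AnalyticOnNhd ℂ (fun s : ℂ => Real.pi / Complex.sin (Real.pi * μ) * s ^ (-μ)) U := by
    intro z hz
    exact analyticAt_const.mul (analyticAt_id.cpow analyticAt_const (Or.inl hz))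
  have hconv : IsPreconnected U := (convex_halfSpace_re_gt 0).isPreconnected
  refine hL.eqOn_of_preconnected_of_frequently_eq hR hconv (z₀ := 1) (by simp [hU]) ?_ hs
  have hreal : ∀ x : ℝ, 0 < x → ∫ t in Ioi (0 : ℝ), (t : ℂ) ^ (-μ) * (1 / ((x : ℂ) + t)) =
      Real.pi / Complex.sin (Real.pi * μ) * (x : ℂ) ^ (-μ) := by
    intro x hx
    have := integral_cpow_mul_one_div_pow (α := 1 - μ) (m := 1) hx (by norm_num [hμ])
      (by norm_num [hμ])
    simp only [Nat.cast_one, pow_one, sub_sub_cancel, sub_sub_cancel_left, Complex.Gamma_one,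
      div_one] at this
    rw [this, one_div, Complex.inv_cpow _ _ (by
      rw [Complex.arg_ofReal_of_nonneg hx.le]; exact Real.pi_pos.ne), ← Complex.cpow_neg,
      mul_assoc, mul_comm (Complex.Gamma (1 - μ)), Complex.Gamma_mul_Gamma_one_sub, mul_comm]
  have hlim : Tendsto (fun x : ℝ => (x : ℂ)) (𝓝[≠] 1) (𝓝[≠] 1) := by
    refine tendsto_nhdsWithin_iff.2 ⟨?_, ?_⟩
    · exact (Complex.continuous_ofReal.tendsto' 1 1 (by simp)).mono_left nhdsWithin_le_nhds
    · filter_upwards [self_mem_nhdsWithin] with x hx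
      simpa using hx
  refine hlim.frequently ?_
  apply Eventually.frequently
  filter_upwards [mem_nhdsWithin_of_mem_nhds (lt_mem_nhds one_pos)] with x hx using hreal x hx

/-- The Mehler integral for the conical function with `P`-parameter `c`: it continues the spherical
function to the complex plane cut along `(-∞, -1]`. -/
noncomputable def conical (lam c : ℂ) : ℂ :=
  Complex.sin (Real.pi * ((1 + lam) / 2)) / Real.pi *
    ∫ t in Ioi (0 : ℝ), (t : ℂ) ^ (-((1 + lam) / 2)) * (1 + 2 * c * t + t ^ 2) ^ (-(1 / 2) : ℂ)

theorem half_one_add_re {lam : ℂ} (h : lam.re = 0) : ((1 + lam) / 2).re = 1 / 2 := by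
  simp [h]

/-- The complement of the cut `(-∞, -1]`. -/
def cutPlane : Set ℂ := {c | ¬ ∃ t : ℝ, t ≤ -1 ∧ c = t}

theorem mem_slitPlane_of_mem_cutPlane {c : ℂ} (hc : c ∈ cutPlane) {t : ℝ} (ht : 0 < t) :
    1 + 2 * c * t + (t : ℂ) ^ 2 ∈ Complex.slitPlane := by
  rw [Complex.mem_slitPlane_iff]
  have him : (1 + 2 * c * t + (t : ℂ) ^ 2).im = 2 * c.im * t := by
    simp [← Complex.ofReal_pow]
  have hre : (1 + 2 * c * t + (t : ℂ) ^ 2).re = 1 + 2 * c.re * t + t ^ 2 := by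
    simp [← Complex.ofReal_pow]
  rw [him, hre]
  by_cases h : c.im = 0
  · left
    have : -1 < c.re := by
      by_contra hcon
      exact hc ⟨c.re, not_lt.1 hcon, Complex.ext (by simp) (by simp [h])⟩
    nlinarith [sq_nonneg (1 - t)]
  · right
    positivity

theorem norm_cpow_neg_half (z : ℂ) : ‖z ^ (-(1 / 2) : ℂ)‖ = ‖z‖ ^ (-(1 / 2) : ℝ) := by
  rw [← Complex.norm_cpow_real]; norm_num

theorem exists_norm_quadratic_ge {c : ℂ} (hc : c ∈ cutPlane) :
    ∃ r > 0, ∀ w ∈ Metric.ball c r, ∀ t : ℝ, 0 < t →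
      r * (1 + t) ^ 2 ≤ ‖1 + 2 * w * t + (t : ℂ) ^ 2‖ := by
  have hcont : ContinuousOn (fun u : ℝ => ‖1 + (c - 1) / 2 * u‖) (Icc 0 1) := by fun_prop
  obtain ⟨u₀, hu₀, hmin⟩ := isCompact_Icc.exists_isMinOn ⟨0, by simp⟩ hcont
  have hpos : 0 < ‖1 + (c - 1) / 2 * u₀‖ := by
    rw [norm_pos_iff]
    intro h
    have hu : (u₀ : ℂ) ≠ 0 := by
      intro h0; rw [h0] at h; simp at h
    have hu' : 0 < u₀ := lt_of_le_of_ne hu₀.1 (by rintro rfl; simp at hu)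
    refine hc ⟨1 - 2 / u₀, ?_, ?_⟩
    · have : 2 ≤ 2 / u₀ := by rw [le_div_iff₀ hu']; linarith [hu₀.2]
      linarith
    · push_cast
      field_simp
      linear_combination 2 * h
  set m := ‖1 + (c - 1) / 2 * u₀‖ with hm
  refine ⟨m / 2, half_pos hpos, fun w hw t ht => ?_⟩
  have h1t : 0 < 1 + t := by linarith
  set u : ℝ := 4 * t / (1 + t) ^ 2 with hu
  have hu0 : 0 ≤ u := by positivity
  have hu1 : u ≤ 1 := by
    rw [hu, div_le_one (by positivity)]; nlinarith [sq_nonneg (1 - t)]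
  have hfac : 1 + 2 * w * t + (t : ℂ) ^ 2 = (1 + (w - 1) / 2 * u) * ((1 + t : ℝ) : ℂ) ^ 2 := by
    have : (1 + t : ℂ) ≠ 0 := by exact_mod_cast h1t.ne'
    rw [hu]; push_cast; field_simp; ring
  rw [hfac, norm_mul, norm_pow, Complex.norm_real, Real.norm_of_nonneg h1t.le]
  have h1 : m ≤ ‖1 + (c - 1) / 2 * u‖ := hmin ⟨hu0, hu1⟩
  have h2 : ‖(w - c) / 2 * u‖ ≤ m / 2 := by
    rw [norm_mul, norm_div, Complex.norm_real, Real.norm_of_nonneg hu0]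
    rw [mem_ball_iff_norm] at hw
    have : ‖w - c‖ / ‖(2 : ℂ)‖ ≤ m / 2 := by
      simp only [Complex.norm_ofNat]
      linarith [norm_nonneg (w - c)]
    calc _ ≤ m / 2 * 1 := by gcongr
      _ = _ := mul_one _
  have h3 : ‖1 + (c - 1) / 2 * u‖ ≤ ‖1 + (w - 1) / 2 * u‖ + ‖(w - c) / 2 * u‖ := by
    have : 1 + (c - 1) / 2 * (u : ℂ) = (1 + (w - 1) / 2 * u) - (w - c) / 2 * u := by ring
    rw [this]; exact norm_sub_le _ _
  gcongr
  linarith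

theorem norm_quadratic_cpow_le {r t : ℝ} {z : ℂ} (hr : 0 < r) (ht : 0 < t)
    (h : r * (1 + t) ^ 2 ≤ ‖z‖) :
    ‖z ^ (-(1 / 2) : ℂ)‖ ≤ r ^ (-(1 / 2) : ℝ) * (1 / (1 + t)) := by
  have h1t : 0 < 1 + t := by linarith
  rw [norm_cpow_neg_half]
  calc ‖z‖ ^ (-(1 / 2) : ℝ) ≤ (r * (1 + t) ^ 2) ^ (-(1 / 2) : ℝ) :=
        Real.rpow_le_rpow_of_nonpos (by positivity) h (by norm_num)
    _ = _ := by
        rw [Real.mul_rpow hr.le (by positivity), ← Real.rpow_natCast, ← Real.rpow_mul h1t.le]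
        norm_num [Real.rpow_neg_one]

theorem conical_integrand_measurable (μ c : ℂ) (ν : Measure ℝ) : AEStronglyMeasurable
    (fun t : ℝ => (t : ℂ) ^ (-μ) * (1 + 2 * c * t + t ^ 2) ^ (-(1 / 2) : ℂ)) ν := by
  apply Measurable.aestronglyMeasurable
  fun_prop

theorem conical_analyticAt {lam : ℂ} (hlam : lam.re = 0) {c : ℂ} (hc : c ∈ cutPlane) :
    AnalyticAt ℂ (conical lam) c := by
  obtain ⟨r, hr, hball⟩ := exists_norm_quadratic_ge hc
  have hopen : ∀ w ∈ Metric.ball c r, w ∈ cutPlane := by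
    rintro w hw ⟨x, hx, rfl⟩
    have hsq : 0 ≤ x ^ 2 - 1 := by nlinarith
    have ht : 0 < -x + √(x ^ 2 - 1) := by linarith [Real.sqrt_nonneg (x ^ 2 - 1)]
    have h := hball _ hw _ ht
    have : 1 + 2 * (x : ℂ) * (-x + √(x ^ 2 - 1) : ℝ) + ((-x + √(x ^ 2 - 1) : ℝ) : ℂ) ^ 2 = 0 := by
      norm_cast
      nlinarith [Real.sq_sqrt hsq]
    rw [this, norm_zero] at h
    nlinarith [mul_pos hr (pow_pos (by linarith : 0 < 1 + (-x + √(x ^ 2 - 1))) 2)]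
  refine analyticAt_const.mul (analyticAt_integral_of_dominated
    (bound := fun t : ℝ => r ^ (-(1 / 2) : ℝ) * (t ^ (-(1 / 2) : ℝ) * (1 / (1 + t)))) hr
    (fun w hw => conical_integrand_measurable _ _ _) ?_ ?_
    ((integrableOn_rpow_neg_half_div one_pos).const_mul _))
  · filter_upwards [ae_restrict_mem measurableSet_Ioi] with t ht w hw
    have h1 : DifferentiableAt ℂ (fun z : ℂ => 1 + 2 * z * t + (t : ℂ) ^ 2) w := by fun_prop
    exact ((differentiableAt_const _).mul (h1.cpow_const
      (mem_slitPlane_of_mem_cutPlane (hopen w hw) ht))).differentiableWithinAt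
  · filter_upwards [ae_restrict_mem measurableSet_Ioi] with t ht w hw
    rw [norm_mul, norm_cpow_neg_of_re_eq (half_one_add_re hlam) ht]
    have := norm_quadratic_cpow_le hr ht (hball w hw t ht)
    calc _ ≤ t ^ (-(1 / 2) : ℝ) * (r ^ (-(1 / 2) : ℝ) * (1 / (1 + t))) := by
          have := Real.rpow_nonneg (le_of_lt (mem_Ioi.1 ht)) (-(1 / 2) : ℝ)
          gcongr
      _ = _ := by ring

/-- The trigonometric polynomial `A cos 2θ + q sin 2θ`. -/
noncomputable def trig (A q : ℂ) (θ : ℝ) : ℂ :=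
  A * (Real.cos (2 * θ) : ℝ) + q * (Real.sin (2 * θ) : ℝ)

theorem continuous_trig (A q : ℂ) : Continuous (trig A q) := by
  unfold trig; fun_prop

theorem norm_trig_le (A q : ℂ) (θ : ℝ) : ‖trig A q θ‖ ≤ ‖A‖ + ‖q‖ := by
  refine (norm_add_le _ _).trans ?_
  rw [norm_mul, norm_mul, Complex.norm_real, Complex.norm_real, Real.norm_eq_abs, Real.norm_eq_abs]
  have h1 := Real.abs_cos_le_one (2 * θ)
  have h2 := Real.abs_sin_le_one (2 * θ)
  nlinarith [norm_nonneg A, norm_nonneg q]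

theorem hasDerivAt_trig (A q : ℂ) (θ : ℝ) :
    HasDerivAt (trig A q) (trig (2 * q) (-(2 * A)) θ) θ := by
  have h2 : HasDerivAt (fun θ : ℝ => 2 * θ) 2 θ := by simpa using (hasDerivAt_id θ).const_mul 2
  have hc := (h2.cos.ofReal_comp).const_mul A
  have hs := (h2.sin.ofReal_comp).const_mul q
  refine (hc.add hs).congr_deriv ?_
  unfold trig; push_cast; ring

theorem trig_sq_add_sq (A q : ℂ) (θ : ℝ) :
    trig (2 * q) (-(2 * A)) θ ^ 2 = 4 * (A ^ 2 + q ^ 2 - trig A q θ ^ 2) := by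
  have h : ((Real.cos (2 * θ) : ℝ) : ℂ) ^ 2 + ((Real.sin (2 * θ) : ℝ) : ℂ) ^ 2 = 1 := by
    norm_cast; exact Real.cos_sq_add_sin_sq _
  unfold trig
  linear_combination (-4 * (A ^ 2 + q ^ 2)) * (-h)

theorem trig_two_pi (A q : ℂ) : trig A q (2 * Real.pi) = trig A q 0 := by
  have h : 2 * (2 * Real.pi) = 0 + 2 * Real.pi + 2 * Real.pi := by ring
  unfold trig
  rw [h, Real.cos_add_two_pi, Real.cos_add_two_pi, Real.sin_add_two_pi, Real.sin_add_two_pi,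
    mul_zero]

theorem trig_half_pi (A q : ℂ) : trig A q (Real.pi / 2) = -trig A q 0 := by
  unfold trig
  rw [mul_div_cancel₀ _ (two_ne_zero)]; simp

/-- The mean over the circle of the reciprocal of a trigonometric polynomial whose real part is
positive. -/
theorem sq_integral_inv_trig {a A q : ℂ} (h : ∀ θ, 0 < (a + trig A q θ).re) :
    (∫ θ in (0 : ℝ)..(2 * Real.pi), 1 / (a + trig A q θ)) ^ 2 * (a ^ 2 - (A ^ 2 + q ^ 2)) =
      (2 * Real.pi) ^ 2 := by
  set g := trig A q with hg
  have hgc : Continuous g := continuous_trig A q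
  have ha : 0 < a.re := by
    have h1 := h 0
    have h2 := h (Real.pi / 2)
    rw [hg, trig_half_pi, ← hg, Complex.add_re, Complex.neg_re] at h2
    rw [Complex.add_re] at h1
    linarith
  have hcont : ContinuousOn (fun θ => (a + g θ).re) (Icc 0 (2 * Real.pi)) := by fun_prop
  obtain ⟨θ₀, -, hmin⟩ := isCompact_Icc.exists_isMinOn
    ⟨0, by simp [Real.pi_pos.le]⟩ hcont
  set δ := min a.re (a + g θ₀).re with hδ
  have hδ0 : 0 < δ := lt_min ha (h _)
  have hseg : ∀ ε ∈ Icc (0 : ℝ) 1, ∀ θ ∈ Icc 0 (2 * Real.pi), δ ≤ (a + ε * g θ).re := by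
    intro ε hε θ hθ
    have h1 : δ ≤ a.re := min_le_left _ _
    have h2 : δ ≤ (a + g θ).re := (min_le_right _ _).trans (hmin hθ)
    simp only [Complex.add_re, Complex.mul_re, Complex.ofReal_re, Complex.ofReal_im, zero_mul,
      sub_zero] at h2 ⊢
    nlinarith [hε.1, hε.2]
  set M := ‖A‖ + ‖q‖ + 1 with hM
  have hM0 : 0 < M := by positivity
  have hgM : ∀ θ, ‖g θ‖ ≤ M := fun θ => (norm_trig_le A q θ).trans (by simp [hM])
  have hnear : ∀ ε ∈ Icc (0 : ℝ) 1, ∀ x ∈ Metric.ball ε (δ / (2 * M)), ∀ θ ∈ Icc 0 (2 * Real.pi),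
      δ / 2 ≤ ‖a + x * g θ‖ := by
    intro ε hε x hx θ hθ
    have h1 := hseg ε hε θ hθ
    have h2 : ‖((x - ε : ℝ) : ℂ) * g θ‖ ≤ δ / 2 := by
      rw [norm_mul, Complex.norm_real]
      rw [mem_ball_iff_norm] at hx
      calc ‖x - ε‖ * ‖g θ‖ ≤ δ / (2 * M) * M := by gcongr; exact hgM θ
        _ = δ / 2 := by field_simp
    have h3 : (a + ε * g θ).re ≤ ‖a + x * g θ‖ + ‖((x - ε : ℝ) : ℂ) * g θ‖ := by
      refine (Complex.re_le_norm _).trans ?_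
      have : a + ε * g θ = (a + x * g θ) - ((x - ε : ℝ) : ℂ) * g θ := by push_cast; ring
      rw [this]; exact norm_sub_le _ _
    linarith
  have hne : ∀ ε ∈ Icc (0 : ℝ) 1, ∀ θ ∈ Icc 0 (2 * Real.pi), a + ε * g θ ≠ 0 := by
    intro ε hε θ hθ h0
    have := hseg ε hε θ hθ
    rw [h0, Complex.zero_re] at this
    linarith
  have hI : uIcc 0 (2 * Real.pi) = Icc 0 (2 * Real.pi) := uIcc_of_le (by positivity)
  have hI' : uIoc 0 (2 * Real.pi) ⊆ Icc 0 (2 * Real.pi) := by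
    rw [uIoc_of_le (by positivity)]; exact Ioc_subset_Icc_self
  set N : ℝ → ℂ := fun ε => ∫ θ in (0 : ℝ)..(2 * Real.pi), 1 / (a + ε * g θ) with hN
  have hN' : ∀ ε ∈ Icc (0 : ℝ) 1,
      HasDerivAt N (∫ θ in (0 : ℝ)..(2 * Real.pi), -g θ / (a + ε * g θ) ^ 2) ε := by
    intro ε hε
    refine (intervalIntegral.hasDerivAt_integral_of_dominated_loc_of_deriv_le (𝕜 := ℝ)
      (F' := fun ε θ => -g θ / (a + ε * g θ) ^ 2)
      (bound := fun _ => M / (δ / 2) ^ 2) (Metric.ball_mem_nhds ε (by positivity :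
        0 < δ / (2 * M))) ?_ ?_ ?_ ?_ (by simp) ?_).2
    · refine Eventually.of_forall fun x => Measurable.aestronglyMeasurable ?_
      have := hgc.measurable
      fun_prop
    · refine ContinuousOn.intervalIntegrable ?_
      rw [hI]
      exact continuousOn_const.div (by fun_prop) (hne ε hε)
    · apply Measurable.aestronglyMeasurable
      have := hgc.measurable
      fun_prop
    · refine Eventually.of_forall fun θ hθ x hx => ?_
      rw [norm_div, norm_neg, norm_pow]
      have := hnear ε hε x hx θ (hI' hθ)
      gcongr
      exact hgM θ
    · refine Eventually.of_forall fun θ hθ x hx => ?_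
      have h0 : a + x * g θ ≠ 0 := by
        intro h0
        have := hnear ε hε x hx θ (hI' hθ)
        rw [h0, norm_zero] at this
        linarith
      have h1 : HasDerivAt (fun x : ℝ => a + x * g θ) (g θ) x := by
        simpa using ((Complex.ofRealCLM.hasDerivAt (x := x)).mul_const (g θ)).const_add a
      simp only [one_div]
      exact h1.inv h0
  set Q := A ^ 2 + q ^ 2 with hQ
  have hzero : ∀ ε ∈ Icc (0 : ℝ) 1,
      ∫ θ in (0 : ℝ)..(2 * Real.pi), (-4 * (a * g θ + ε * Q)) / (a + ε * g θ) ^ 2 = 0 := by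
    intro ε hε
    have := intervalIntegral.integral_eq_sub_of_hasDerivAt (a := 0) (b := 2 * Real.pi)
      (f := fun θ => trig (2 * q) (-(2 * A)) θ / (a + ε * g θ))
      (f' := fun θ => (-4 * (a * g θ + ε * Q)) / (a + ε * g θ) ^ 2) ?_ ?_
    · rw [this]
      simp only [hg, trig_two_pi, sub_self]
    · intro θ hθ
      rw [hI] at hθ
      have h1 := (hasDerivAt_trig (2 * q) (-(2 * A)) θ)
      have h2 := ((hasDerivAt_trig A q θ).const_mul (ε : ℂ)).const_add a
      refine (h1.div h2 (hne ε hε θ hθ)).congr_deriv ?_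
      congr 1
      have h3 := trig_sq_add_sq A q θ
      have h4 : trig (2 * -(2 * A)) (-(2 * (2 * q))) θ = -4 * g θ := by
        simp only [hg, trig]; ring
      rw [h4]
      simp only [← hg] at h3 ⊢
      rw [hQ]
      linear_combination (-(ε : ℂ)) * h3
    · refine ContinuousOn.intervalIntegrable ?_
      rw [hI]
      exact ContinuousOn.div (by fun_prop) (by fun_prop) fun θ hθ => pow_ne_zero _ (hne ε hε θ hθ)
  have hode : ∀ ε ∈ Icc (0 : ℝ) 1,
      (a ^ 2 - ε ^ 2 * Q) * (∫ θ in (0 : ℝ)..(2 * Real.pi), -g θ / (a + ε * g θ) ^ 2) -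
        ε * Q * N ε = 0 := by
    intro ε hε
    have hi1 : IntervalIntegrable (fun θ => -g θ / (a + ε * g θ) ^ 2) volume 0 (2 * Real.pi) := by
      refine ContinuousOn.intervalIntegrable ?_
      rw [hI]
      exact ContinuousOn.div (by fun_prop) (by fun_prop) fun θ hθ => pow_ne_zero _ (hne ε hε θ hθ)
    have hi2 : IntervalIntegrable (fun θ => 1 / (a + ε * g θ)) volume 0 (2 * Real.pi) := by
      refine ContinuousOn.intervalIntegrable ?_
      rw [hI]
      exact ContinuousOn.div (by fun_prop) (by fun_prop) (hne ε hε)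
    have := hzero ε hε
    rw [hN]
    simp only
    rw [← intervalIntegral.integral_const_mul, ← intervalIntegral.integral_const_mul,
      ← intervalIntegral.integral_sub (hi1.const_mul _) (hi2.const_mul _)]
    have h2 : (a / 4) * ∫ θ in (0 : ℝ)..(2 * Real.pi),
        (-4 * (a * g θ + ε * Q)) / (a + ε * g θ) ^ 2 = 0 := by rw [this, mul_zero]
    rw [← intervalIntegral.integral_const_mul] at h2
    rw [← h2]
    refine intervalIntegral.integral_congr fun θ hθ => ?_
    rw [hI] at hθ
    have := hne ε hε θ hθ
    field_simp
    ring
  have hconst : ∀ ε ∈ Icc (0 : ℝ) 1,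
      N ε ^ 2 * (a ^ 2 - ε ^ 2 * Q) = N 0 ^ 2 * (a ^ 2 - (0 : ℝ) ^ 2 * Q) := by
    have hder : ∀ ε ∈ Icc (0 : ℝ) 1,
        HasDerivAt (fun ε : ℝ => N ε ^ 2 * (a ^ 2 - ε ^ 2 * Q)) 0 ε := by
      intro ε hε
      have h1 := hN' ε hε
      have h2 : HasDerivAt (fun ε : ℝ => a ^ 2 - (ε : ℂ) ^ 2 * Q) (-(2 * ε * Q)) ε := by
        have := (((Complex.ofRealCLM.hasDerivAt (x := ε)).pow 2).mul_const Q).const_sub (a ^ 2)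
        simpa using this
      refine ((h1.pow 2).mul h2).congr_deriv ?_
      have := hode ε hε
      rw [Pi.pow_apply]
      push_cast
      linear_combination (2 * N ε) * this
    refine constant_of_has_deriv_right_zero (f := fun ε : ℝ => N ε ^ 2 * (a ^ 2 - ε ^ 2 * Q)) ?_ ?_
    · exact fun ε hε => (hder ε hε).continuousAt.continuousWithinAt
    · exact fun ε hε => (hder ε (Ico_subset_Icc_self hε)).hasDerivWithinAt
  have h1 := hconst 1 (by simp)
  have ha0 : a ≠ 0 := by rintro rfl; simp at ha
  simp only [hN, Complex.ofReal_one, one_mul, Complex.ofReal_zero, zero_mul, add_zero,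
    intervalIntegral.integral_const, one_pow] at h1
  rw [h1, sub_zero, Complex.real_smul]
  push_cast
  field_simp
  simp

theorem re_integral_inv_trig_pos {a A q : ℂ} (h : ∀ θ, 0 < (a + trig A q θ).re) :
    0 < (∫ θ in (0 : ℝ)..(2 * Real.pi), 1 / (a + trig A q θ)).re := by
  have hcont : Continuous fun θ => 1 / (a + trig A q θ) := by
    have := continuous_trig A q
    refine continuous_const.div (by fun_prop) fun θ h0 => ?_
    have := h θ
    rw [h0] at this
    simp at this
  have hre : (∫ θ in (0 : ℝ)..(2 * Real.pi), 1 / (a + trig A q θ)).re =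
      ∫ θ in (0 : ℝ)..(2 * Real.pi), (1 / (a + trig A q θ)).re :=
    (intervalIntegral.intervalIntegral_re (hcont.intervalIntegrable _ _)).symm
  rw [hre]
  refine intervalIntegral.intervalIntegral_pos_of_pos
    ((Complex.continuous_re.comp hcont).intervalIntegrable _ _) (fun θ => ?_) (by positivity)
  rw [one_div, Complex.inv_re]
  have h0 : a + trig A q θ ≠ 0 := by
    intro h0
    have := h θ
    rw [h0] at this
    simp at this
  exact div_pos (h θ) (Complex.normSq_pos.2 h0)

theorem re_cpow_neg_half_pos {z : ℂ} (hz : z ∈ Complex.slitPlane) :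
    0 < (z ^ (-(1 / 2) : ℂ)).re := by
  rw [Complex.cpow_def_of_ne_zero (Complex.slitPlane_ne_zero hz), Complex.exp_re]
  refine mul_pos (Real.exp_pos _) (Real.cos_pos_of_mem_Ioo ?_)
  have h1 := Complex.neg_pi_lt_arg z
  have h2 := Complex.arg_le_pi z
  have h3 := (Complex.mem_slitPlane_iff_arg.1 hz).1
  have h4 : z.arg < Real.pi := lt_of_le_of_ne h2 h3
  have : (Complex.log z * (-(1 / 2) : ℂ)).im = -z.arg / 2 := by
    rw [Complex.mul_im, Complex.log_im]
    norm_num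
    ring
  rw [this]
  constructor <;> linarith

theorem cpow_neg_half_sq {z : ℂ} (hz : z ≠ 0) : (z ^ (-(1 / 2) : ℂ)) ^ 2 * z = 1 := by
  rw [← Complex.cpow_nat_mul]
  norm_num [Complex.cpow_neg_one, hz]

theorem eq_cpow_neg_half {z N : ℂ} (hz : z ∈ Complex.slitPlane) (hN : 0 < N.re)
    (h : N ^ 2 * z = 1) : N = z ^ (-(1 / 2) : ℂ) := by
  have hz0 := Complex.slitPlane_ne_zero hz
  have h1 : N ^ 2 = (z ^ (-(1 / 2) : ℂ)) ^ 2 :=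
    mul_right_cancel₀ hz0 (h.trans (cpow_neg_half_sq hz0).symm)
  rcases sq_eq_sq_iff_eq_or_eq_neg.1 h1 with h2 | h2
  · exact h2
  · have h3 := re_cpow_neg_half_pos hz
    rw [h2, Complex.neg_re] at hN
    linarith

/-- The mean over the circle of the powers of exponent `-μ` of a trigonometric polynomial. -/
theorem integral_trig_cpow {lam c A q : ℂ} (hlam : lam.re = 0)
    (h : ∀ θ, 0 < (c + trig A q θ).re) (hQ : A ^ 2 + q ^ 2 = c ^ 2 - 1) :
    (2 * Real.pi : ℂ)⁻¹ * ∫ θ in (0 : ℝ)..(2 * Real.pi), (c + trig A q θ) ^ (-((1 + lam) / 2)) =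
      conical lam c := by
  set μ := (1 + lam) / 2 with hμdef
  have hμ : μ.re = 1 / 2 := half_one_add_re hlam
  have hgc : Continuous (trig A q) := continuous_trig A q
  have hc : 0 < c.re := by
    have h1 := h 0
    have h2 := h (Real.pi / 2)
    rw [trig_half_pi, Complex.add_re, Complex.neg_re] at h2
    rw [Complex.add_re] at h1
    linarith
  have hcut : c ∈ cutPlane := by
    rintro ⟨t, ht, rfl⟩
    rw [Complex.ofReal_re] at hc
    linarith
  have hcont : ContinuousOn (fun θ => (c + trig A q θ).re) (Icc 0 (2 * Real.pi)) := by fun_prop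
  obtain ⟨θ₀, -, hmin⟩ := isCompact_Icc.exists_isMinOn
    ⟨0, by simp [Real.pi_pos.le]⟩ hcont
  set δ := (c + trig A q θ₀).re with hδ
  have hδ0 : 0 < δ := h _
  have hsin : Complex.sin (Real.pi * μ) ≠ 0 := by
    intro h0
    have h1 := Complex.Gamma_mul_Gamma_one_sub μ
    rw [h0, div_zero] at h1
    exact mul_ne_zero (Complex.Gamma_ne_zero_of_re_pos (by rw [hμ]; norm_num))
      (Complex.Gamma_ne_zero_of_re_pos (by rw [Complex.sub_re, hμ]; norm_num)) h1
  have hpi : (Real.pi : ℂ) ≠ 0 := by exact_mod_cast Real.pi_ne_zero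
  have hpow : ∀ θ, (c + trig A q θ) ^ (-μ) = Complex.sin (Real.pi * μ) / Real.pi *
      ∫ t in Ioi (0 : ℝ), (t : ℂ) ^ (-μ) * (1 / ((c + trig A q θ) + t)) := by
    intro θ
    rw [integral_cpow_neg_mul_one_div_add hμ (h θ), ← mul_assoc, div_mul_div_comm,
      mul_comm (Complex.sin _), div_self (mul_ne_zero hpi hsin), one_mul]
  have hmeas : AEStronglyMeasurable
      (Function.uncurry fun (θ t : ℝ) => (t : ℂ) ^ (-μ) * (1 / ((c + trig A q θ) + t)))
      ((volume.restrict (Ioc 0 (2 * Real.pi))).prod (volume.restrict (Ioi 0))) := by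
    apply Measurable.aestronglyMeasurable
    have := hgc.measurable
    simp only [Function.uncurry_def]
    fun_prop
  have hint : Integrable
      (Function.uncurry fun (θ t : ℝ) => (t : ℂ) ^ (-μ) * (1 / ((c + trig A q θ) + t)))
      ((volume.restrict (Ioc 0 (2 * Real.pi))).prod (volume.restrict (Ioi 0))) := by
    have h1 : Integrable (fun _ : ℝ => (1 : ℝ)) (volume.restrict (Ioc 0 (2 * Real.pi))) := by
      simp
    refine (h1.mul_prod (integrableOn_rpow_neg_half_div hδ0)).mono' hmeas ?_
    rw [Measure.prod_restrict]
    filter_upwards [ae_restrict_mem (measurableSet_Ioc.prod measurableSet_Ioi)] with p hp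
    obtain ⟨hp1, hp2⟩ := hp
    simp only [Function.uncurry, norm_mul, one_mul]
    rw [norm_cpow_neg_of_re_eq hμ hp2]
    have h2 := norm_one_div_add_le hδ0 (hmin (Ioc_subset_Icc_self hp1)) hp2
    have h3 := Real.rpow_nonneg (le_of_lt (mem_Ioi.1 hp2)) (-(1 / 2) : ℝ)
    gcongr
  have hinner : ∀ t ∈ Ioi (0 : ℝ), ∫ θ in Ioc 0 (2 * Real.pi),
      (t : ℂ) ^ (-μ) * (1 / ((c + trig A q θ) + t)) =
      (2 * Real.pi) * ((t : ℂ) ^ (-μ) * (1 + 2 * c * t + t ^ 2) ^ (-(1 / 2) : ℂ)) := by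
    intro t ht
    have ht0 : 0 < t := ht
    have hpos : ∀ θ, 0 < ((c + t) + trig A q θ).re := by
      intro θ
      have := h θ
      simp only [Complex.add_re, Complex.ofReal_re] at this ⊢
      linarith
    have h1 := sq_integral_inv_trig hpos
    have h2 := re_integral_inv_trig_pos hpos
    have h3 : (∫ θ in (0 : ℝ)..(2 * Real.pi), 1 / ((c + t) + trig A q θ)) / (2 * Real.pi) =
        (1 + 2 * c * t + (t : ℂ) ^ 2) ^ (-(1 / 2) : ℂ) := by
      refine eq_cpow_neg_half (mem_slitPlane_of_mem_cutPlane hcut ht0) ?_ ?_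
      · have : (2 * Real.pi : ℂ) = ((2 * Real.pi : ℝ) : ℂ) := by push_cast; rfl
        rw [this, Complex.div_ofReal_re]
        positivity
      · rw [hQ] at h1
        rw [div_pow]
        field_simp
        linear_combination h1
    rw [← h3, integral_const_mul, intervalIntegral.integral_of_le (by positivity)]
    have : ∀ θ, c + trig A q θ + t = c + t + trig A q θ := fun θ => by ring
    simp only [this]
    field_simp
  rw [intervalIntegral.integral_of_le (by positivity)]
  simp only [hpow]
  rw [integral_const_mul, integral_integral_swap hint, setIntegral_congr_fun measurableSet_Ioi hinner,
    integral_const_mul, conical, ← hμdef]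
  field_simp

/-- The binomial coefficients of `(1 - y) ^ (-1 / 2)`. -/
noncomputable def invSqrtCoeff (n : ℕ) : ℝ := Ring.choose ((1 / 2 : ℝ) + n - 1) n

theorem invSqrtCoeff_eq (n : ℕ) :
    (n.factorial : ℝ) * invSqrtCoeff n = (ascPochhammer ℝ n).eval (1 / 2) := by
  have h := Ring.factorial_nsmul_multichoose_eq_ascPochhammer (1 / 2 : ℝ) n
  rw [invSqrtCoeff, Ring.choose, show (1 / 2 : ℝ) + n - 1 - n + 1 = 1 / 2 by ring, ← nsmul_eq_mul, h,
    Polynomial.eval_eq_smeval, Polynomial.ascPochhammer_smeval_cast (R := ℝ)]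

theorem invSqrtCoeff_zero : invSqrtCoeff 0 = 1 := by
  simpa using invSqrtCoeff_eq 0

theorem invSqrtCoeff_succ (n : ℕ) :
    invSqrtCoeff (n + 1) = invSqrtCoeff n * ((n + 1 / 2) / (n + 1)) := by
  have h1 := invSqrtCoeff_eq n
  have h2 := invSqrtCoeff_eq (n + 1)
  rw [ascPochhammer_succ_eval, ← h1, Nat.factorial_succ] at h2
  have h3 : (n.factorial : ℝ) ≠ 0 := by positivity
  push_cast at h2
  have h4 : (n.factorial : ℝ) * (invSqrtCoeff (n + 1) * (n + 1)) =
      n.factorial * (invSqrtCoeff n * (n + 1 / 2)) := by linear_combination h2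
  have h5 := mul_left_cancel₀ h3 h4
  field_simp
  linear_combination 2 * h5

theorem invSqrtCoeff_pos (n : ℕ) : 0 < invSqrtCoeff n := by
  induction n with
  | zero => simp [invSqrtCoeff_zero]
  | succ n ih => rw [invSqrtCoeff_succ]; positivity

theorem invSqrtCoeff_le_one (n : ℕ) : invSqrtCoeff n ≤ 1 := by
  induction n with
  | zero => simp [invSqrtCoeff_zero]
  | succ n ih =>
    rw [invSqrtCoeff_succ]
    refine mul_le_one₀ ih (by positivity) ?_
    rw [div_le_one (by positivity)]
    linarith

theorem hasSum_invSqrtCoeff {y : ℝ} (hy : |y| < 1) :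
    HasSum (fun n => invSqrtCoeff n * y ^ n) ((1 - y) ^ (-(1 / 2) : ℝ)) := by
  have h := (Real.one_div_one_sub_rpow_hasFPowerSeriesOnBall_zero (1 / 2)).hasSum (y := y)
    (by simpa [Metric.mem_eball, edist_dist, Real.dist_eq] using hy)
  simp only [FormalMultilinearSeries.ofScalars_apply_eq, zero_add, smul_eq_mul] at h
  rw [Real.rpow_neg (by linarith [(abs_lt.1 hy).2]), ← one_div]
  exact h

/-- The Taylor coefficients of the conical function at `1`, in the variable `(1 - c) / 2`. -/
noncomputable def conicalCoeff (lam : ℂ) (n : ℕ) : ℝ :=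
  invSqrtCoeff n * 4 ^ n * Complex.normSq (Complex.Gamma (n + (1 + lam) / 2)) /
    (Complex.normSq (Complex.Gamma ((1 + lam) / 2)) * (2 * n).factorial)

theorem add_half_re_pos {lam : ℂ} (hlam : lam.re = 0) (n : ℕ) :
    0 < ((n : ℂ) + (1 + lam) / 2).re := by
  rw [Complex.add_re, half_one_add_re hlam, Complex.natCast_re]
  positivity

theorem conicalCoeff_pos {lam : ℂ} (hlam : lam.re = 0) (n : ℕ) : 0 < conicalCoeff lam n := by
  have h1 := Complex.normSq_pos.2 (Complex.Gamma_ne_zero_of_re_pos (add_half_re_pos hlam n))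
  have h2 := Complex.normSq_pos.2 (Complex.Gamma_ne_zero_of_re_pos (add_half_re_pos hlam 0))
  rw [Nat.cast_zero, zero_add] at h2
  have := invSqrtCoeff_pos n
  unfold conicalCoeff
  positivity

theorem conicalCoeff_succ {lam : ℂ} (hlam : lam.re = 0) (n : ℕ) :
    conicalCoeff lam (n + 1) =
      conicalCoeff lam n * (Complex.normSq (n + (1 + lam) / 2) / (n + 1) ^ 2) := by
  have h0 : (n : ℂ) + (1 + lam) / 2 ≠ 0 := by
    intro h
    have := add_half_re_pos hlam n
    rw [h] at this
    simp at this
  have h1 : Complex.Gamma ((n + 1 : ℕ) + (1 + lam) / 2) =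
      (n + (1 + lam) / 2) * Complex.Gamma (n + (1 + lam) / 2) := by
    rw [← Complex.Gamma_add_one _ h0]; congr 1; push_cast; ring
  have h2 := Complex.normSq_pos.2 (Complex.Gamma_ne_zero_of_re_pos (add_half_re_pos hlam 0))
  rw [Nat.cast_zero, zero_add] at h2
  have h3 : ((2 * (n + 1)).factorial : ℝ) = (2 * n + 2) * (2 * n + 1) * (2 * n).factorial := by
    rw [show 2 * (n + 1) = 2 * n + 1 + 1 by ring, Nat.factorial_succ, Nat.factorial_succ]
    push_cast; ring
  unfold conicalCoeff
  rw [h1, invSqrtCoeff_succ, map_mul, h3]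
  have h4 : ((2 * n).factorial : ℝ) ≠ 0 := by positivity
  generalize Complex.normSq (Complex.Gamma ((1 + lam) / 2)) = G at *
  generalize Complex.normSq (Complex.Gamma ((n : ℂ) + (1 + lam) / 2)) = H at *
  generalize Complex.normSq ((n : ℂ) + (1 + lam) / 2) = J at *
  field_simp
  ring

theorem conicalCoeff_one_div_le {lam : ℂ} (hlam : lam.re = 0) (n : ℕ) :
    conicalCoeff lam 1 / (n + 1) ≤ conicalCoeff lam (n + 1) := by
  induction n with
  | zero => simp
  | succ n ih =>
    rw [conicalCoeff_succ hlam (n + 1)]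
    have h1 : ((n + 1 : ℕ) + 1 / 2 : ℝ) ^ 2 ≤ Complex.normSq ((n + 1 : ℕ) + (1 + lam) / 2) := by
      rw [Complex.normSq_apply]
      have : ((n + 1 : ℕ) + (1 + lam) / 2 : ℂ).re = (n + 1 : ℕ) + 1 / 2 := by
        rw [Complex.add_re, half_one_add_re hlam, Complex.natCast_re]
      rw [this]
      nlinarith [mul_self_nonneg ((n + 1 : ℕ) + (1 + lam) / 2 : ℂ).im]
    have h2 : ((n : ℝ) + 1) / (n + 2) ≤
        Complex.normSq ((n + 1 : ℕ) + (1 + lam) / 2) / ((n + 1 : ℕ) + 1) ^ 2 := by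
      rw [div_le_div_iff₀ (by positivity) (by positivity)]
      push_cast at h1 ⊢
      have h3 : (0 : ℝ) < n + 2 := by positivity
      nlinarith
    calc conicalCoeff lam 1 / ((n + 1 : ℕ) + 1)
        = conicalCoeff lam 1 / (n + 1) * (((n : ℝ) + 1) / (n + 2)) := by
          push_cast; field_simp; ring
      _ ≤ _ := by
          have := conicalCoeff_pos hlam (n + 1)
          gcongr

theorem conicalCoeff_eq {lam : ℂ} (hlam : lam.re = 0) (n : ℕ) :
    (conicalCoeff lam n : ℂ) = Complex.sin (Real.pi * ((1 + lam) / 2)) / Real.pi *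
      (invSqrtCoeff n * 4 ^ n * (Complex.Gamma (n + 1 - (1 + lam) / 2) *
        Complex.Gamma (n + (1 + lam) / 2) / Complex.Gamma (2 * n + 1))) := by
  have hconj : (starRingEnd ℂ) ((1 + lam) / 2) = 1 - (1 + lam) / 2 := by
    refine Complex.ext ?_ ?_
    · rw [Complex.conj_re, Complex.sub_re, half_one_add_re hlam]; norm_num
    · rw [Complex.conj_im]; simp
  have hG : ∀ k : ℕ, Complex.Gamma (k + 1 - (1 + lam) / 2) * Complex.Gamma (k + (1 + lam) / 2) =
      Complex.normSq (Complex.Gamma (k + (1 + lam) / 2)) := by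
    intro k
    rw [← Complex.mul_conj, ← Complex.Gamma_conj, map_add, hconj, Complex.conj_natCast, mul_comm]
    congr 2; ring
  have h0 := hG 0
  simp only [Nat.cast_zero, zero_add] at h0
  have h1 := Complex.Gamma_mul_Gamma_one_sub ((1 + lam) / 2)
  rw [mul_comm, h0] at h1
  have hne := Complex.normSq_pos.2 (Complex.Gamma_ne_zero_of_re_pos (add_half_re_pos hlam 0))
  rw [Nat.cast_zero, zero_add] at hne
  have hsin : Complex.sin (Real.pi * ((1 + lam) / 2)) / Real.pi =
      ((Complex.normSq (Complex.Gamma ((1 + lam) / 2)) : ℝ) : ℂ)⁻¹ := by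
    rw [h1, inv_div]
  have hfac : Complex.Gamma (2 * n + 1) = ((2 * n).factorial : ℂ) := by
    rw [← Complex.Gamma_nat_eq_factorial]; push_cast; rfl
  rw [hsin, hG, hfac, conicalCoeff]
  push_cast
  rw [div_eq_mul_inv, mul_inv]
  ring

theorem hasSum_conical {lam : ℂ} (hlam : lam.re = 0) {x : ℝ} (hx0 : 0 ≤ x) (hx1 : x < 1) :
    HasSum (fun n => (conicalCoeff lam n : ℂ) * x ^ n) (conical lam ((1 - 2 * x : ℝ) : ℂ)) := by
  set μ := (1 + lam) / 2 with hμdef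
  have hμ : μ.re = 1 / 2 := half_one_add_re hlam
  set F : ℕ → ℝ → ℂ := fun n t => (invSqrtCoeff n * (4 * x) ^ n : ℝ) *
    ((t : ℂ) ^ ((n + 1 - μ) - 1) * (1 / ((1 : ℝ) + t : ℂ)) ^ (2 * n + 1)) with hF
  have hFeq : ∀ n, ∀ t ∈ Ioi (0 : ℝ), F n t = (t : ℂ) ^ (-μ) *
      ((invSqrtCoeff n * (x * (4 * t / (1 + t) ^ 2)) ^ n * (1 / (1 + t)) : ℝ) : ℂ) := by
    intro n t ht
    have ht0 : (t : ℂ) ≠ 0 := by exact_mod_cast (mem_Ioi.1 ht).ne'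
    have h1t : (1 + t : ℂ) ≠ 0 := by
      have : (1 + t : ℝ) ≠ 0 := by linarith [mem_Ioi.1 ht]
      exact_mod_cast this
    have : (t : ℂ) ^ ((n + 1 - μ) - 1) = (t : ℂ) ^ n * (t : ℂ) ^ (-μ) := by
      rw [← Complex.cpow_natCast, ← Complex.cpow_add _ _ ht0]; congr 1; ring
    rw [hF]; simp only
    rw [this]
    push_cast
    simp only [mul_pow, div_pow, one_pow, pow_succ, pow_mul]
    field_simp
  have hu : ∀ t ∈ Ioi (0 : ℝ), 0 ≤ 4 * t / (1 + t) ^ 2 ∧ 4 * t / (1 + t) ^ 2 ≤ 1 := by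
    intro t ht
    have ht : 0 < t := ht
    refine ⟨by positivity, ?_⟩
    rw [div_le_one (by positivity)]; nlinarith [sq_nonneg (1 - t)]
  have hFn : ∀ n, ∀ t ∈ Ioi (0 : ℝ), ‖F n t‖ ≤ x ^ n * (t ^ (-(1 / 2) : ℝ) * (1 / (1 + t))) := by
    intro n t ht
    obtain ⟨hu0, hu1⟩ := hu t ht
    have ht' : 0 < t := ht
    rw [hFeq n t ht, norm_mul, norm_cpow_neg_of_re_eq hμ ht, Complex.norm_real, norm_mul, norm_mul,
      norm_pow, Real.norm_of_nonneg (invSqrtCoeff_pos n).le, Real.norm_of_nonneg (by positivity),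
      Real.norm_of_nonneg (by positivity)]
    have h1 : (x * (4 * t / (1 + t) ^ 2)) ^ n ≤ x ^ n :=
      pow_le_pow_left₀ (by positivity) (mul_le_of_le_one_right hx0 hu1) n
    have h2 := invSqrtCoeff_le_one n
    have h3 := (invSqrtCoeff_pos n).le
    have h4 : invSqrtCoeff n * (x * (4 * t / (1 + t) ^ 2)) ^ n ≤ x ^ n :=
      (mul_le_of_le_one_left (by positivity) h2).trans h1
    calc _ ≤ t ^ (-(1 / 2) : ℝ) * (x ^ n * (1 / (1 + t))) := by gcongr
      _ = _ := by ring
  have hmeas : ∀ n, AEStronglyMeasurable (F n) (volume.restrict (Ioi 0)) := by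
    intro n
    apply Measurable.aestronglyMeasurable
    fun_prop
  have hb := integrableOn_rpow_neg_half_div one_pos
  have hint : ∀ n, Integrable (F n) (volume.restrict (Ioi 0)) := by
    intro n
    refine (hb.const_mul (x ^ n)).mono' (hmeas n) ?_
    filter_upwards [ae_restrict_mem measurableSet_Ioi] with t ht using hFn n t ht
  have hsum : Summable fun n => ∫ t in Ioi (0 : ℝ), ‖F n t‖ := by
    refine Summable.of_nonneg_of_le (fun n => integral_nonneg fun t => norm_nonneg _) (fun n => ?_)
      ((summable_geometric_of_lt_one hx0 hx1).mul_right
        (∫ t in Ioi (0 : ℝ), t ^ (-(1 / 2) : ℝ) * (1 / (1 + t))))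
    rw [← integral_const_mul]
    exact setIntegral_mono_on (hint n).norm (hb.const_mul _) measurableSet_Ioi (hFn n)
  have hkey := hasSum_integral_of_summable_integral_norm hint hsum
  have htsum : ∀ t ∈ Ioi (0 : ℝ), ∑' n, F n t =
      (t : ℂ) ^ (-μ) * (1 + 2 * ((1 - 2 * x : ℝ) : ℂ) * t + t ^ 2) ^ (-(1 / 2) : ℂ) := by
    intro t ht
    obtain ⟨hu0, hu1⟩ := hu t ht
    have ht' : 0 < t := ht
    have hy : x * (4 * t / (1 + t) ^ 2) < 1 := (mul_le_of_le_one_right hx0 hu1).trans_lt hx1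
    have h1 := (hasSum_invSqrtCoeff (y := x * (4 * t / (1 + t) ^ 2))
      (by rw [abs_of_nonneg (by positivity)]; exact hy)).mul_right (1 / (1 + t))
    have h2 := (h1.map Complex.ofRealHom Complex.continuous_ofReal).mul_left ((t : ℂ) ^ (-μ))
    have h3 : (1 - x * (4 * t / (1 + t) ^ 2)) ^ (-(1 / 2) : ℝ) * (1 / (1 + t)) =
        (1 + 2 * (1 - 2 * x) * t + t ^ 2) ^ (-(1 / 2) : ℝ) := by
      have : 1 + 2 * (1 - 2 * x) * t + t ^ 2 =
          (1 - x * (4 * t / (1 + t) ^ 2)) * (1 + t) ^ 2 := by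
        field_simp; ring
      rw [this, Real.mul_rpow (by linarith) (by positivity), ← Real.rpow_natCast,
        ← Real.rpow_mul (by linarith)]
      norm_num [Real.rpow_neg_one]
    have h4 : 0 ≤ 1 + 2 * (1 - 2 * x) * t + t ^ 2 := by nlinarith [sq_nonneg (1 - t)]
    rw [h3] at h2
    have h5 : (Complex.ofRealHom ((1 + 2 * (1 - 2 * x) * t + t ^ 2) ^ (-(1 / 2) : ℝ)) : ℂ) =
        (1 + 2 * ((1 - 2 * x : ℝ) : ℂ) * t + t ^ 2) ^ (-(1 / 2) : ℂ) := by
      rw [Complex.ofRealHom_eq_coe, Complex.ofReal_cpow h4]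
      push_cast; rfl
    rw [h5] at h2
    rw [← h2.tsum_eq]
    refine tsum_congr fun n => ?_
    rw [hFeq n t ht]
    rfl
  rw [setIntegral_congr_fun measurableSet_Ioi htsum] at hkey
  have hterm : ∀ n, ∫ t in Ioi (0 : ℝ), F n t = (invSqrtCoeff n * (4 * x) ^ n : ℝ) *
      (Complex.Gamma (n + 1 - μ) * Complex.Gamma (n + μ) / Complex.Gamma (2 * n + 1)) := by
    intro n
    have h := integral_cpow_mul_one_div_pow (α := n + 1 - μ) (m := 2 * n + 1) one_pos
      (by simp [hμ]; linarith [n.cast_nonneg (α := ℝ)])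
      (by simp [hμ]; linarith [n.cast_nonneg (α := ℝ)])
    rw [hF]; simp only
    rw [integral_const_mul, h]
    push_cast
    rw [one_div_one, Complex.one_cpow, one_mul, show (2 * n + 1 - (n + 1 - μ) : ℂ) = n + μ by ring]
  have hfin := hkey.mul_left (Complex.sin (Real.pi * μ) / Real.pi)
  refine (funext fun n => ?_ : (fun n => (conicalCoeff lam n : ℂ) * x ^ n) = _) ▸ hfin
  rw [hterm, conicalCoeff_eq hlam]
  push_cast
  rw [mul_pow]
  ring

/-- The conical function is real and positive on `(-1, 1]`, with a logarithmic singularity at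
`-1`. -/
theorem conical_real {lam : ℂ} (hlam : lam.re = 0) {c : ℝ} (h1 : -1 < c) (h2 : c ≤ 1) :
    0 < (conical lam c).re ∧ (conical lam c).im = 0 ∧
      conicalCoeff lam 1 * (-Real.log ((1 + c) / 2)) ≤ (conical lam c).re := by
  set x := (1 - c) / 2 with hx
  have hx0 : 0 ≤ x := by rw [hx]; linarith
  have hx1 : x < 1 := by rw [hx]; linarith
  have h := hasSum_conical hlam hx0 hx1
  rw [show 1 - 2 * x = c by rw [hx]; ring] at h
  have hre : HasSum (fun n => conicalCoeff lam n * x ^ n) (conical lam c).re := by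
    convert Complex.hasSum_re h using 2 with n
    rw [← Complex.ofReal_pow, ← Complex.ofReal_mul, Complex.ofReal_re]
  have him : (conical lam c).im = 0 := by
    refine (Complex.hasSum_im h).unique ?_
    convert hasSum_zero with n
    rw [← Complex.ofReal_pow, ← Complex.ofReal_mul, Complex.ofReal_im]
  have hnn : ∀ n, 0 ≤ conicalCoeff lam n * x ^ n := fun n =>
    mul_nonneg (conicalCoeff_pos hlam n).le (pow_nonneg hx0 n)
  refine ⟨?_, him, ?_⟩
  · have := le_hasSum hre 0 fun n _ => hnn n
    rw [pow_zero, mul_one] at this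
    exact (conicalCoeff_pos hlam 0).trans_le this
  · have hlog := (Real.hasSum_pow_div_log_of_abs_lt_one (x := x)
      (by rwa [abs_of_nonneg hx0])).mul_left (conicalCoeff lam 1)
    rw [show 1 - x = (1 + c) / 2 by rw [hx]; ring] at hlog
    have htail : HasSum (fun n => conicalCoeff lam (n + 1) * x ^ (n + 1))
        ((conical lam c).re - ∑ i ∈ Finset.range 1, conicalCoeff lam i * x ^ i) :=
      (hasSum_nat_add_iff' 1).2 hre
    have := hasSum_le (fun n => ?_) hlog htail
    · refine this.trans ?_
      simpa using hnn 0
    · calc conicalCoeff lam 1 * (x ^ (n + 1) / (n + 1))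
          = conicalCoeff lam 1 / (n + 1) * x ^ (n + 1) := by ring
        _ ≤ _ := by
          gcongr
          exact conicalCoeff_one_div_le hlam n

theorem symMat_smul (g : SL(2, ℂ)) (z : XC) :
    symMat (g • z) = g.1 * symMat z * g.1.transpose := by
  obtain ⟨h, rfl⟩ := QuotientGroup.mk_surjective z
  rw [smul_mk, symMat_mk, symMat_mk, Matrix.SpecialLinearGroup.coe_mul, Matrix.transpose_mul]
  simp only [Matrix.mul_assoc]

theorem symMat_symm (z : XC) : symMat z 1 0 = symMat z 0 1 := by
  obtain ⟨h, rfl⟩ := QuotientGroup.mk_surjective z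
  simp [symMat_mk, Matrix.mul_apply, Fin.sum_univ_two, mul_comm]

theorem symMat_det (z : XC) : symMat z 0 0 * symMat z 1 1 - symMat z 0 1 ^ 2 = 1 := by
  obtain ⟨h, rfl⟩ := QuotientGroup.mk_surjective z
  have hdet := h.2
  rw [Matrix.det_fin_two] at hdet
  simp only [symMat_mk, Matrix.mul_apply, Fin.sum_univ_two, Matrix.transpose_apply]
  linear_combination (h.1 0 0 * h.1 1 1 - h.1 0 1 * h.1 1 0 + 1) * hdet

theorem symMat_injective : Function.Injective symMat := by
  intro z w h
  obtain ⟨a, rfl⟩ := QuotientGroup.mk_surjective z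
  obtain ⟨b, rfl⟩ := QuotientGroup.mk_surjective w
  rw [symMat_mk, symMat_mk] at h
  rw [QuotientGroup.eq]
  change (a⁻¹ * b).1 * (a⁻¹ * b).1.transpose = 1
  have h1 : (a⁻¹).1 * a.1 = 1 := by
    rw [← Matrix.SpecialLinearGroup.coe_mul]; simp
  calc (a⁻¹ * b).1 * (a⁻¹ * b).1.transpose
      = (a⁻¹).1 * (b.1 * b.1.transpose) * (a⁻¹).1.transpose := by
        simp only [Matrix.SpecialLinearGroup.coe_mul, Matrix.transpose_mul, Matrix.mul_assoc]
    _ = ((a⁻¹).1 * a.1) * ((a⁻¹).1 * a.1).transpose := by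
        rw [← h]; simp only [Matrix.transpose_mul, Matrix.mul_assoc]
    _ = 1 := by rw [h1]; simp

theorem symMat_ext {z w : XC} (h00 : symMat z 0 0 = symMat w 0 0)
    (h01 : symMat z 0 1 = symMat w 0 1) (h11 : symMat z 1 1 = symMat w 1 1) : z = w := by
  apply symMat_injective
  ext i j
  fin_cases i <;> fin_cases j
  · exact h00
  · exact h01
  · exact (symMat_symm z).trans (h01.trans (symMat_symm w).symm)
  · exact h11

theorem continuous_symMat : Continuous symMat := by
  refine Continuous.quotient_lift ?_ _
  have : Continuous fun z : SL(2, ℂ) => z.1 := continuous_subtype_val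
  exact this.matrix_mul this.matrix_transpose

theorem P_eq (z : XC) : P z = symMat z 0 0 + symMat z 1 1 := Matrix.trace_fin_two _

theorem toC_apply (g : SL(2, ℝ)) (i j : Fin 2) : (toC g).1 i j = (g.1 i j : ℂ) := rfl

theorem symMat_toC_smul_apply (g : SL(2, ℝ)) (z : XC) (i j : Fin 2) :
    symMat (toC g • z) i j =
      (g.1 i 0 * symMat z 0 0 + g.1 i 1 * symMat z 0 1) * g.1 j 0 +
      (g.1 i 0 * symMat z 0 1 + g.1 i 1 * symMat z 1 1) * g.1 j 1 := by
  rw [symMat_smul]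
  simp [toC, Matrix.mul_apply, Fin.sum_univ_two, symMat_symm]

theorem symMat_expA (w : ℂ) : symMat (expA w • basePt) 0 0 = Complex.exp (2 * w) ∧
    symMat (expA w • basePt) 0 1 = 0 ∧ symMat (expA w • basePt) 1 1 = Complex.exp (-(2 * w)) := by
  rw [basePt, smul_mk, symMat_mk, mul_one, coe_expA']
  simp only [Matrix.mul_apply, Fin.sum_univ_two, Matrix.transpose_apply]
  refine ⟨?_, ?_, ?_⟩ <;> simp [← Complex.exp_add] <;> ring_nf

theorem symMat_expI (y : ℝ) :
    symMat (expI y) 0 0 = Real.cos (2 * y) + Real.sin (2 * y) * Complex.I ∧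
    symMat (expI y) 0 1 = 0 ∧
    symMat (expI y) 1 1 = Real.cos (2 * y) - Real.sin (2 * y) * Complex.I := by
  obtain ⟨h1, h2, h3⟩ := symMat_expA (y * Complex.I)
  refine ⟨?_, h2, ?_⟩
  · rw [expI, h1, ← mul_assoc, Complex.exp_mul_I]; simp
  · rw [expI, h3, ← mul_assoc, ← neg_mul, Complex.exp_mul_I]
    simp [sub_eq_add_neg]

theorem toC_smul_mem_crown (g : SL(2, ℝ)) {z : XC} (hz : z ∈ crown) : toC g • z ∈ crown := by
  obtain ⟨h, y, hy, rfl⟩ := hz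
  exact ⟨g * h, y, hy, by rw [map_mul, mul_smul]⟩

theorem mem_crown_of_toC_smul (g : SL(2, ℝ)) {z : XC} (hz : toC g • z ∈ crown) : z ∈ crown := by
  have := toC_smul_mem_crown g⁻¹ hz
  rwa [map_inv, inv_smul_smul] at this

theorem zero_mem_Omega : (0 : ℝ) ∈ Omega := by
  constructor <;> linarith [Real.pi_pos]

theorem realX_subset_crown : realX ⊆ crown := by
  rintro _ ⟨g, rfl⟩
  refine ⟨g, 0, zero_mem_Omega, ?_⟩
  have : expI 0 = basePt := by
    obtain ⟨h1, h2, h3⟩ := symMat_expI 0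
    apply symMat_ext <;> simp [*, basePt, symMat_mk]
  rw [this]

/-- The diagonal matrix `diag (t, t⁻¹)`. -/
noncomputable def diagR (t : ℝ) (ht : t ≠ 0) : SL(2, ℝ) :=
  ⟨!![t, 0; 0, t⁻¹], by rw [Matrix.det_fin_two_of]; field_simp; simp⟩

/-- The real upper triangular unipotent matrices. -/
def unipR (x : ℝ) : SL(2, ℝ) := ⟨!![1, x; 0, 1], by simp [Matrix.det_fin_two_of]⟩

theorem toC_diagR_exp (s : ℝ) : toC (diagR (Real.exp s) (Real.exp_pos s).ne') = expA s := by
  ext i j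
  rw [toC_apply]
  fin_cases i <;> fin_cases j <;> simp [diagR, expA, Complex.exp_neg]

theorem toC_unipR (x : ℝ) : toC (unipR x) = unip x := by
  ext i j
  rw [toC_apply]
  fin_cases i <;> fin_cases j <;> simp [unipR, unip]

theorem symMat_unip (x : ℂ) (z : XC) :
    symMat (unip x • z) 0 0 = symMat z 0 0 + 2 * x * symMat z 0 1 + x ^ 2 * symMat z 1 1 ∧
    symMat (unip x • z) 0 1 = symMat z 0 1 + x * symMat z 1 1 ∧
    symMat (unip x • z) 1 1 = symMat z 1 1 := by
  have h := symMat_symm z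
  rw [symMat_smul, coe_unip]
  refine ⟨?_, ?_, ?_⟩ <;>
    simp [Matrix.mul_apply, Fin.sum_univ_two, Matrix.vecMul, dotProduct, h]
  all_goals ring

theorem symMat_unipR (x : ℝ) (z : XC) :
    symMat (toC (unipR x) • z) 0 0 = symMat z 0 0 + 2 * x * symMat z 0 1 + x ^ 2 * symMat z 1 1 ∧
    symMat (toC (unipR x) • z) 0 1 = symMat z 0 1 + x * symMat z 1 1 ∧
    symMat (toC (unipR x) • z) 1 1 = symMat z 1 1 := by
  rw [toC_unipR]
  exact symMat_unip x z

theorem symMat_diagR (t : ℝ) (ht : t ≠ 0) (z : XC) :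
    symMat (toC (diagR t ht) • z) 0 0 = t ^ 2 * symMat z 0 0 ∧
    symMat (toC (diagR t ht) • z) 0 1 = symMat z 0 1 ∧
    symMat (toC (diagR t ht) • z) 1 1 = (t⁻¹) ^ 2 * symMat z 1 1 := by
  have : (t : ℂ) ≠ 0 := by exact_mod_cast ht
  refine ⟨?_, ?_, ?_⟩ <;> rw [symMat_toC_smul_apply] <;> simp [diagR]
  all_goals field_simp

theorem exists_polar (a b : ℝ) : ∃ ρ θ : ℝ, 0 ≤ ρ ∧ a = ρ * Real.cos (2 * θ) ∧
    b = ρ * Real.sin (2 * θ) := by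
  refine ⟨‖(⟨a, b⟩ : ℂ)‖, (⟨a, b⟩ : ℂ).arg / 2, norm_nonneg _, ?_, ?_⟩
  · rw [mul_div_cancel₀ _ two_ne_zero, Complex.norm_mul_cos_arg]
  · rw [mul_div_cancel₀ _ two_ne_zero, Complex.norm_mul_sin_arg]

theorem mem_crown_of_re_eq {z : XC} (h01 : (symMat z 0 1).re = 0)
    (h : (symMat z 0 0).re = (symMat z 1 1).re) (hpos : 0 < (symMat z 1 1).re) : z ∈ crown := by
  have hdet := symMat_det z
  have hre := congrArg Complex.re hdet
  have him := congrArg Complex.im hdet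
  simp only [pow_two, Complex.sub_re, Complex.mul_re, Complex.sub_im, Complex.mul_im, h01, h,
    Complex.one_re, Complex.one_im] at hre him
  set r := (symMat z 1 1).re with hr
  have hm : (symMat z 1 1).im = -(symMat z 0 0).im := by
    have : r * ((symMat z 1 1).im + (symMat z 0 0).im) = 0 := by linear_combination him
    rcases mul_eq_zero.1 this with h0 | h0
    · exact absurd h0 hpos.ne'
    · linarith
  obtain ⟨ρ, θ, hρ, ha, hb⟩ := exists_polar (symMat z 0 0).im (symMat z 0 1).im
  rw [hm] at hre
  have hcs := Real.cos_sq_add_sin_sq (2 * θ)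
  have hnorm : r ^ 2 + ρ ^ 2 = 1 := by
    rw [ha, hb] at hre
    linear_combination hre - ρ ^ 2 * hcs
  have hρ1 : ρ < 1 := by nlinarith
  set y := Real.arcsin ρ / 2 with hy
  have hsin : Real.sin (2 * y) = ρ := by
    rw [hy, mul_div_cancel₀ _ two_ne_zero, Real.sin_arcsin (by linarith) hρ1.le]
  have hcos : Real.cos (2 * y) = r := by
    rw [hy, mul_div_cancel₀ _ two_ne_zero, Real.cos_arcsin,
      show 1 - ρ ^ 2 = r ^ 2 by linarith, Real.sqrt_sq hpos.le]
  have hyΩ : y ∈ Omega := by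
    have h1 := Real.arcsin_lt_pi_div_two.2 hρ1
    have h2 := Real.arcsin_nonneg.2 hρ
    constructor <;> rw [hy] <;> linarith [Real.pi_pos]
  obtain ⟨e00, e01, e11⟩ := symMat_expI y
  rw [hsin, hcos] at e00 e11
  have h2c : Real.cos (2 * θ) = Real.cos θ ^ 2 - Real.sin θ ^ 2 := Real.cos_two_mul' θ
  have h2s : Real.sin (2 * θ) = 2 * Real.sin θ * Real.cos θ := Real.sin_two_mul θ
  have hcs1 : ((Real.cos θ : ℝ) : ℂ) ^ 2 + ((Real.sin θ : ℝ) : ℂ) ^ 2 = 1 := by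
    exact_mod_cast Real.cos_sq_add_sin_sq θ
  rw [h2c] at ha
  rw [h2s] at hb
  have hz00 : symMat z 0 0 = r + (symMat z 0 0).im * Complex.I := by
    rw [← h, Complex.re_add_im]
  have hz01 : symMat z 0 1 = (symMat z 0 1).im * Complex.I := by
    conv_lhs => rw [← Complex.re_add_im (symMat z 0 1), h01]
    simp
  have hz11 : symMat z 1 1 = r - (symMat z 0 0).im * Complex.I := by
    conv_lhs => rw [← Complex.re_add_im (symMat z 1 1), hm, ← hr]
    push_cast; ring
  refine ⟨rot θ, y, hyΩ, symMat_ext ?_ ?_ ?_⟩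
  · rw [symMat_toC_smul_apply, e00, e01, e11, hz00, ha]
    simp only [rot, Matrix.of_apply, Matrix.cons_val_zero, Matrix.cons_val_one, Matrix.cons_val']
    push_cast [← Complex.ofReal_cos, ← Complex.ofReal_sin] at hcs1 ⊢
    linear_combination (-(r : ℂ)) * hcs1
  · rw [symMat_toC_smul_apply, e00, e01, e11, hz01, hb]
    simp only [rot, Matrix.of_apply, Matrix.cons_val_zero, Matrix.cons_val_one, Matrix.cons_val']
    push_cast
    ring
  · rw [symMat_toC_smul_apply, e00, e01, e11, hz11, ha]
    simp only [rot, Matrix.of_apply, Matrix.cons_val_zero, Matrix.cons_val_one, Matrix.cons_val']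
    push_cast at hcs1 ⊢
    linear_combination (-(r : ℂ)) * hcs1

/-- The crown is the set of points whose symmetric matrix has positive definite real part. -/
theorem mem_crown_iff {z : XC} : z ∈ crown ↔ 0 < (symMat z 1 1).re ∧
    (symMat z 0 1).re ^ 2 < (symMat z 0 0).re * (symMat z 1 1).re := by
  constructor
  · intro hz
    refine ⟨re_symMat_pos hz, ?_⟩
    obtain ⟨g, y, hy, rfl⟩ := hz
    obtain ⟨e00, e01, e11⟩ := symMat_expI y
    have hc : 0 < Real.cos (2 * y) :=
      Real.cos_pos_of_mem_Ioo ⟨by linarith [hy.1], by linarith [hy.2]⟩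
    have hdet := g.2
    rw [Matrix.det_fin_two] at hdet
    simp only [symMat_toC_smul_apply, e00, e01, e11]
    simp [-Complex.ofReal_cos, -Complex.ofReal_sin]
    nlinarith [mul_pos hc hc, congrArg (fun x => Real.cos (2 * y) ^ 2 * x ^ 2) hdet]
  · rintro ⟨h1, h2⟩
    set R00 := (symMat z 0 0).re with hR00
    set R01 := (symMat z 0 1).re with hR01
    set R11 := (symMat z 1 1).re with hR11
    have hD : 0 < (R00 * R11 - R01 ^ 2) := by linarith
    apply mem_crown_of_toC_smul (unipR (-R01 / R11))
    obtain ⟨u00, u01, u11⟩ := symMat_unipR (-R01 / R11) z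
    have v00 := congrArg Complex.re u00
    have v01 := congrArg Complex.re u01
    have v11 := congrArg Complex.re u11
    have hcast : ((-R01 / R11 : ℝ) : ℂ) ^ 2 = (((-R01 / R11) ^ 2 : ℝ) : ℂ) := by push_cast; rfl
    have hcast2 : (2 : ℂ) * ((-R01 / R11 : ℝ) : ℂ) = ((2 * (-R01 / R11) : ℝ) : ℂ) := by
      push_cast; rfl
    rw [hcast, hcast2] at v00
    simp only [Complex.add_re, Complex.re_ofReal_mul, ← hR00, ← hR01, ← hR11] at v00 v01 v11
    set w := toC (unipR (-R01 / R11)) • z with hw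
    have w01 : (symMat w 0 1).re = 0 := by rw [v01]; field_simp; ring
    have w00 : 0 < (symMat w 0 0).re := by
      have : (symMat w 0 0).re = (R00 * R11 - R01 ^ 2) / R11 := by rw [v00]; field_simp; ring
      rw [this]; positivity
    set t := √(√(R11 / (symMat w 0 0).re)) with ht
    have ht0 : 0 < t := by positivity
    have ht4 : t ^ 4 * (symMat w 0 0).re = R11 := by
      have : t ^ 4 = R11 / (symMat w 0 0).re := by
        rw [show t ^ 4 = (t ^ 2) ^ 2 by ring, ht, Real.sq_sqrt (by positivity),
          Real.sq_sqrt (by positivity)]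
      rw [this]; field_simp
    apply mem_crown_of_toC_smul (diagR t ht0.ne')
    obtain ⟨d00, d01, d11⟩ := symMat_diagR t ht0.ne' w
    have c1 : ((t : ℂ) ^ 2) = ((t ^ 2 : ℝ) : ℂ) := by push_cast; rfl
    have c2 : (((t⁻¹ : ℝ) : ℂ) ^ 2) = (((t⁻¹) ^ 2 : ℝ) : ℂ) := by push_cast; rfl
    rw [c1] at d00
    rw [c2] at d11
    apply mem_crown_of_re_eq
    · rw [d01, w01]
    · rw [d00, d11, Complex.re_ofReal_mul, Complex.re_ofReal_mul, v11, ← ht4]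
      field_simp
    · rw [d11, Complex.re_ofReal_mul, v11]; positivity

theorem isOpen_crown : IsOpen crown := by
  have hent : ∀ i j, Continuous fun z : XC => (symMat z i j).re := fun i j =>
    Complex.continuous_re.comp (continuous_symMat.matrix_elem i j)
  have : crown = {z | 0 < (symMat z 1 1).re} ∩
      {z | (symMat z 0 1).re ^ 2 < (symMat z 0 0).re * (symMat z 1 1).re} := by
    ext z; exact mem_crown_iff
  rw [this]
  exact (isOpen_lt continuous_const (hent 1 1)).inter
    (isOpen_lt ((hent 0 1).pow 2) ((hent 0 0).mul (hent 1 1)))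

theorem exists_iwasawa (g : SL(2, ℝ)) : ∃ x s θ : ℝ,
    toC g = unip x * expA s * toC (rot θ) := by
  have hdet := g.2
  rw [Matrix.det_fin_two] at hdet
  set ρ := ‖(⟨g.1 1 1, g.1 1 0⟩ : ℂ)‖ with hρ
  set θ := (⟨g.1 1 1, g.1 1 0⟩ : ℂ).arg with hθ
  have hd : ρ * Real.cos θ = g.1 1 1 := Complex.norm_mul_cos_arg _
  have hc : ρ * Real.sin θ = g.1 1 0 := Complex.norm_mul_sin_arg _
  have hcs := Real.cos_sq_add_sin_sq θ
  have hρ0 : 0 < ρ := by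
    rcases (norm_nonneg (⟨g.1 1 1, g.1 1 0⟩ : ℂ)).lt_or_eq with h | h
    · exact h
    · rw [hρ, ← h, zero_mul] at hc
      rw [hρ, ← h, zero_mul] at hd
      rw [← hc, ← hd] at hdet
      simp at hdet
  have e1 : Complex.exp ((-Real.log ρ : ℝ) : ℂ) = (ρ : ℂ)⁻¹ := by
    rw [← Complex.ofReal_exp, Real.exp_neg, Real.exp_log hρ0]; push_cast; rfl
  have e2 : Complex.exp (-((-Real.log ρ : ℝ) : ℂ)) = (ρ : ℂ) := by
    rw [← Complex.ofReal_neg, neg_neg, ← Complex.ofReal_exp, Real.exp_log hρ0]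
  refine ⟨(g.1 0 0 * Real.sin θ + g.1 0 1 * Real.cos θ) / ρ, -Real.log ρ, θ, ?_⟩
  have hca : g.1 0 0 = ρ⁻¹ * Real.cos θ +
      (g.1 0 0 * Real.sin θ + g.1 0 1 * Real.cos θ) / ρ * (ρ * Real.sin θ) := by
    rw [← hd, ← hc] at hdet
    field_simp
    linear_combination (-g.1 0 0 * ρ) * hcs + Real.cos θ * hdet
  have hcb : g.1 0 1 = -(ρ⁻¹ * Real.sin θ) +
      (g.1 0 0 * Real.sin θ + g.1 0 1 * Real.cos θ) / ρ * (ρ * Real.cos θ) := by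
    rw [← hd, ← hc] at hdet
    field_simp
    linear_combination (-g.1 0 1 * ρ) * hcs - Real.sin θ * hdet
  ext i j
  rw [Matrix.SpecialLinearGroup.coe_mul, Matrix.SpecialLinearGroup.coe_mul, coe_unip, coe_expA',
    e1, e2]
  fin_cases i <;> fin_cases j <;>
    simp only [Matrix.mul_apply, Fin.sum_univ_two, toC_apply] <;>
    simp [rot, -Complex.ofReal_cos, -Complex.ofReal_sin]
  · rw [← Complex.ofReal_inj] at hca
    push_cast [-Complex.ofReal_cos, -Complex.ofReal_sin] at hca ⊢
    linear_combination hca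
  · rw [← Complex.ofReal_inj] at hcb
    push_cast [-Complex.ofReal_cos, -Complex.ofReal_sin] at hcb ⊢
    linear_combination hcb
  · exact_mod_cast hc.symm
  · exact_mod_cast hd.symm

theorem continuous_expA : Continuous expA := by
  refine Continuous.subtype_mk ?_ _
  refine continuous_matrix fun i j => ?_
  fin_cases i <;> fin_cases j <;> simp <;> fun_prop

theorem continuous_unip : Continuous unip := by
  refine Continuous.subtype_mk ?_ _
  refine continuous_matrix fun i j => ?_
  fin_cases i <;> fin_cases j <;> simp <;> fun_prop

theorem continuous_toC_rot : Continuous fun θ => toC (rot θ) := by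
  refine Continuous.subtype_mk ?_ _
  refine continuous_matrix fun i j => ?_
  fin_cases i <;> fin_cases j <;>
    simp [rot, -Complex.ofReal_cos, -Complex.ofReal_sin] <;> fun_prop

theorem isConnected_crown : IsConnected crown := by
  refine ⟨⟨expI 0, 1, 0, zero_mem_Omega, by simp⟩, ?_⟩
  set Φ : ℝ × ℝ × ℝ × ℝ → XC := fun p =>
    ((unip p.1 * expA p.2.1 * toC (rot p.2.2.1) * expA (p.2.2.2 * Complex.I) : SL(2, ℂ)) : XC)
  have hΦ : Continuous Φ := by
    refine QuotientGroup.continuous_mk.comp ?_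
    refine ((Continuous.mul ?_ ?_).mul ?_).mul ?_
    · exact continuous_unip.comp (by fun_prop)
    · exact continuous_expA.comp (by fun_prop)
    · exact continuous_toC_rot.comp (by fun_prop)
    · exact continuous_expA.comp (by fun_prop)
  have hΩ : IsPreconnected Omega := isPreconnected_Ioo
  have himg : crown = Φ '' (univ ×ˢ univ ×ˢ univ ×ˢ Omega) := by
    ext z
    constructor
    · rintro ⟨g, y, hy, rfl⟩
      obtain ⟨x, s, θ, hg⟩ := exists_iwasawa g
      refine ⟨(x, s, θ, y), by simpa using hy, ?_⟩
      rw [hg, expI, basePt, smul_mk, smul_mk, mul_one]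
    · rintro ⟨⟨x, s, θ, y⟩, hp, rfl⟩
      have hy : y ∈ Omega := by simpa using hp
      refine ⟨unipR x * diagR (Real.exp s) (Real.exp_pos s).ne' * rot θ, y, hy, ?_⟩
      rw [map_mul, map_mul, toC_unipR, toC_diagR_exp, expI, basePt, smul_mk, smul_mk, mul_one]
  rw [himg]
  exact (isPreconnected_univ.prod (isPreconnected_univ.prod
    (isPreconnected_univ.prod hΩ))).image _ hΦ.continuousOn

theorem isGDomain_crown : IsGDomain crown :=
  ⟨isOpen_crown, isConnected_crown, fun g _ hz => toC_smul_mem_crown g hz⟩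

theorem re_P_pos {z : XC} (hz : z ∈ crown) : 0 < (P z).re := by
  obtain ⟨h1, h2⟩ := mem_crown_iff.1 hz
  rw [P_eq, Complex.add_re]
  have : 0 < (symMat z 0 0).re := by
    by_contra h
    nlinarith [sq_nonneg (symMat z 0 1).re]
  linarith

theorem mem_XHat_iff {z : XC} : z ∈ XHat ↔ P z / 2 ∈ cutPlane := by
  unfold XHat cutPlane
  simp only [mem_ofPred_eq, not_iff_not]
  constructor
  · rintro ⟨t, ht, h⟩
    exact ⟨t / 2, by linarith, by rw [h]; push_cast; ring⟩
  · rintro ⟨t, ht, h⟩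
    refine ⟨2 * t, by linarith, ?_⟩
    push_cast
    linear_combination 2 * h

theorem crown_subset_XHat : crown ⊆ XHat := by
  rintro z hz ⟨t, ht, h⟩
  have := re_P_pos hz
  rw [h, Complex.ofReal_re] at this
  linarith

/-- On the crown the spherical function is the conical function of `P / 2`. -/
theorem spherical_eq_conical {lam : ℂ} (hlam : lam.re = 0) {z : XC} (hz : z ∈ crown) :
    spherical lam z = conical lam (P z / 2) := by
  have hS : ∀ θ, symMat (toC (rot θ) • z) 1 1 =
      P z / 2 + trig ((symMat z 1 1 - symMat z 0 0) / 2) (symMat z 0 1) θ := by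
    intro θ
    have hcs1 : ((Real.cos θ : ℝ) : ℂ) ^ 2 + ((Real.sin θ : ℝ) : ℂ) ^ 2 = 1 := by
      exact_mod_cast Real.cos_sq_add_sin_sq θ
    rw [symMat_toC_smul_apply, P_eq, trig, Real.cos_two_mul', Real.sin_two_mul]
    simp only [rot, Matrix.of_apply, Matrix.cons_val_zero, Matrix.cons_val_one, Matrix.cons_val']
    push_cast at hcs1 ⊢
    linear_combination ((symMat z 0 0 + symMat z 1 1) / 2) * hcs1
  have hpos : ∀ θ, 0 < (P z / 2 + trig ((symMat z 1 1 - symMat z 0 0) / 2) (symMat z 0 1) θ).re := by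
    intro θ
    rw [← hS]
    exact re_symMat_pos (toC_smul_mem_crown _ hz)
  have hQ : ((symMat z 1 1 - symMat z 0 0) / 2) ^ 2 + symMat z 0 1 ^ 2 = (P z / 2) ^ 2 - 1 := by
    rw [P_eq]
    linear_combination -symMat_det z
  rw [← integral_trig_cpow hlam hpos hQ, spherical]
  congr 2
  funext θ
  have hne : symMat (toC (rot θ) • z) 1 1 ≠ 0 := by
    intro h
    have := hpos θ
    rw [← hS, h] at this
    simp at this
  rw [logA, ← hS, Complex.cpow_def_of_ne_zero hne]
  congr 1
  ring

theorem P_KC_smul {k : SL(2, ℂ)} (hk : k ∈ KC) (z : XC) : P (k • z) = P z := by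
  have hk' : k.1 * k.1.transpose = 1 := hk
  rw [P, P, symMat_smul, Matrix.trace_mul_comm, ← Matrix.mul_assoc,
    mul_eq_one_comm.1 hk', Matrix.one_mul]

theorem HolomorphicOn.congr {f f' : XC → ℂ} {U : Set XC} (hf : HolomorphicOn f U) (hU : IsOpen U)
    (h : EqOn f f' U) : HolomorphicOn f' U := by
  intro g hg
  obtain ⟨F, hF, hev⟩ := hf g hg
  refine ⟨F, hF, ?_⟩
  have hmem : ∀ᶠ k : SL(2, ℂ) in 𝓝 g, (k : XC) ∈ U :=
    (QuotientGroup.continuous_mk.continuousAt (x := g)) (hU.mem_nhds hg)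
  filter_upwards [hev, hmem] with k hk hkU
  rw [← h hkU, hk]

theorem HolomorphicOn.mono {f : XC → ℂ} {U V : Set XC} (hf : HolomorphicOn f U) (hV : V ⊆ U) :
    HolomorphicOn f V :=
  fun g hg => hf g (hV hg)

theorem HolomorphicOn.analyticAt_comp {f : XC → ℂ} {U : Set XC} (hf : HolomorphicOn f U)
    {h : ℂ → SL(2, ℂ)} {w : ℂ} (hh : ∀ i j, AnalyticAt ℂ (fun w => (h w).1 i j) w)
    (hw : (h w : XC) ∈ U) : AnalyticAt ℂ (fun w => f (h w : XC)) w := by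
  obtain ⟨F, hF, hev⟩ := hf (h w) hw
  have hcont : ContinuousAt h w := by
    have hind : Topology.IsInducing (fun k : SL(2, ℂ) => k.1) := ⟨rfl⟩
    refine hind.continuousAt_iff.2 ?_
    exact continuousAt_pi.2 fun i => continuousAt_pi.2 fun j => (hh i j).continuousAt
  have hM : AnalyticAt ℂ (fun w => fun i j => (h w).1 i j) w :=
    AnalyticAt.pi fun i => AnalyticAt.pi fun j => hh i j
  refine (hF.comp_of_eq hM rfl).congr ?_
  filter_upwards [hcont.eventually hev] with x hx
  exact hx.symm

theorem holomorphicOn_conical {lam : ℂ} (hlam : lam.re = 0) :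
    HolomorphicOn (fun z => conical lam (P z / 2)) XHat := by
  intro g hg
  have hPval : ∀ k : SL(2, ℂ), P (k : XC) = k.1 0 0 * k.1 0 0 + k.1 0 1 * k.1 0 1 +
      (k.1 1 0 * k.1 1 0 + k.1 1 1 * k.1 1 1) := by
    intro k
    rw [P_eq, symMat_mk]
    simp [Matrix.mul_apply, Fin.sum_univ_two]
  have hcoord : ∀ i j : Fin 2, AnalyticAt ℂ (fun M : Fin 2 → Fin 2 → ℂ => M i j)
      (fun i j => g.1 i j) := fun i j =>
    ((ContinuousLinearMap.proj (R := ℂ) (φ := fun _ : Fin 2 => ℂ) j).comp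
      (ContinuousLinearMap.proj (R := ℂ) (φ := fun _ : Fin 2 => Fin 2 → ℂ) i)).analyticAt _
  refine ⟨fun M => conical lam ((M 0 0 * M 0 0 + M 0 1 * M 0 1 +
      (M 1 0 * M 1 0 + M 1 1 * M 1 1)) / 2), ?_, ?_⟩
  · refine (conical_analyticAt hlam (mem_XHat_iff.1 hg)).comp_of_eq
      (g := conical lam) (f := fun M : Fin 2 → Fin 2 → ℂ => (M 0 0 * M 0 0 + M 0 1 * M 0 1 +
      (M 1 0 * M 1 0 + M 1 1 * M 1 1)) / 2) ?_ ?_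
    · exact ((((hcoord 0 0).mul (hcoord 0 0)).add ((hcoord 0 1).mul (hcoord 0 1))).add
        (((hcoord 1 0).mul (hcoord 1 0)).add ((hcoord 1 1).mul (hcoord 1 1)))).div_const
    · simp only [hPval]
  · exact Eventually.of_forall fun k => by simp only [hPval]

theorem holomorphicOn_spherical {lam : ℂ} (hlam : lam.re = 0) :
    HolomorphicOn (spherical lam) crown :=
  ((holomorphicOn_conical hlam).mono crown_subset_XHat).congr isOpen_crown
    fun _ hz => (spherical_eq_conical hlam hz).symm

/-- Analytic continuation along a segment in a holomorphic curve. -/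
theorem eq_conical_of_segment {lam : ℂ} (hlam : lam.re = 0) {U : Set XC} {F : XC → ℂ}
    (hF : HolomorphicOn F U) {h : ℂ → SL(2, ℂ)}
    (hh : ∀ w i j, AnalyticAt ℂ (fun w => (h w).1 i j) w) {T : ℝ}
    (hU : ∀ t ∈ uIcc 0 T, (h t : XC) ∈ U) (hX : ∀ t ∈ uIcc 0 T, (h t : XC) ∈ XHat)
    (hfreq : ∃ᶠ w in 𝓝[≠] 0, F (h w : XC) = conical lam (P (h w : XC) / 2)) :
    F (h T : XC) = conical lam (P (h T : XC) / 2) := by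
  have hpre : IsPreconnected ((fun t : ℝ => (t : ℂ)) '' uIcc 0 T) :=
    isPreconnected_uIcc.image _ Complex.continuous_ofReal.continuousOn
  refine AnalyticOnNhd.eqOn_of_preconnected_of_frequently_eq
    (f := fun w => F (h w : XC)) (g := fun w => conical lam (P (h w : XC) / 2))
    (U := (fun t : ℝ => (t : ℂ)) '' uIcc 0 T) ?_ ?_ hpre (z₀ := 0) ⟨0, left_mem_uIcc, by simp⟩
    hfreq ⟨T, right_mem_uIcc, rfl⟩
  · rintro _ ⟨t, ht, rfl⟩
    exact hF.analyticAt_comp (hh _) (hU t ht)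
  · rintro _ ⟨t, ht, rfl⟩
    exact (holomorphicOn_conical hlam).analyticAt_comp (hh _) (hX t ht)

theorem mem_XHat_of_P_eq {z : XC} {x : ℝ} (h : P z = x) (hx : -2 < x) : z ∈ XHat := by
  rintro ⟨t, ht, h'⟩
  rw [h, Complex.ofReal_inj] at h'
  linarith

theorem tendsto_conical_atTop {lam : ℂ} (hlam : lam.re = 0) :
    Tendsto (fun c : ℝ => (conical lam c).re) (𝓝[>] (-1)) atTop := by
  have h1 : Tendsto (fun c : ℝ => (1 + c) / 2) (𝓝[>] (-1)) (𝓝[>] 0) := by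
    refine tendsto_nhdsWithin_iff.2 ⟨?_, ?_⟩
    · have : Continuous fun c : ℝ => (1 + c) / 2 := by fun_prop
      exact (this.tendsto' (-1) 0 (by norm_num)).mono_left nhdsWithin_le_nhds
    · filter_upwards [self_mem_nhdsWithin] with c hc
      have : -1 < c := hc
      have : 0 < (1 + c) / 2 := by linarith
      exact this
  have h2 := (tendsto_neg_atBot_atTop.comp (Real.tendsto_log_nhdsGT_zero.comp h1)).const_mul_atTop
    (conicalCoeff_pos hlam 1)
  refine tendsto_atTop_mono' _ ?_ h2
  have hlt : ∀ᶠ c : ℝ in 𝓝[>] (-1), c < 1 :=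
    mem_nhdsWithin_of_mem_nhds (gt_mem_nhds (by norm_num))
  filter_upwards [self_mem_nhdsWithin, hlt] with c hc hc1
  exact (conical_real hlam hc hc1.le).2.2

/-- The lower triangular unipotent matrices. -/
def lowC (w : ℂ) : SL(2, ℂ) := ⟨!![1, 0; w, 1], by simp [Matrix.det_fin_two_of]⟩

/-- The slice `exp (diag (s, -s)) (1, 0; i b, 1) · x_o`, transversal to the generic part of the
boundary of the crown. -/
noncomputable def slice (s b : ℂ) : SL(2, ℂ) := expA s * lowC (Complex.I * b)

theorem coe_slice (s b : ℂ) : (slice s b).1 =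
    !![Complex.exp s, 0; Complex.exp (-s) * (Complex.I * b), Complex.exp (-s)] := by
  rw [slice, Matrix.SpecialLinearGroup.coe_mul, coe_expA', lowC]
  ext i j
  fin_cases i <;> fin_cases j <;> simp [Matrix.mul_apply, Fin.sum_univ_two]

theorem symMat_slice (s b : ℂ) : symMat (slice s b : XC) 0 0 = Complex.exp (2 * s) ∧
    symMat (slice s b : XC) 0 1 = Complex.I * b ∧
    symMat (slice s b : XC) 1 1 = Complex.exp (-(2 * s)) * (1 - b ^ 2) := by
  have h1 : Complex.exp (2 * s) = Complex.exp s * Complex.exp s := by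
    rw [← Complex.exp_add]; ring_nf
  have h2 : Complex.exp (-(2 * s)) = Complex.exp (-s) * Complex.exp (-s) := by
    rw [← Complex.exp_add]; ring_nf
  have h3 : Complex.exp s * Complex.exp (-s) = 1 := by rw [← Complex.exp_add]; simp
  rw [symMat_mk, coe_slice, h1, h2]
  simp only [Matrix.mul_apply, Fin.sum_univ_two, Matrix.transpose_apply]
  simp only [Matrix.of_apply, Matrix.cons_val_zero, Matrix.cons_val_one, Matrix.cons_val']
  refine ⟨by ring, ?_, ?_⟩
  · linear_combination (Complex.I * b) * h3
  · linear_combination (Complex.exp (-s) * Complex.exp (-s) * b ^ 2) * Complex.I_sq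

theorem P_slice (s b : ℝ) : P (slice s b : XC) =
    ((Real.exp (2 * s) + Real.exp (-(2 * s)) * (1 - b ^ 2) : ℝ) : ℂ) := by
  obtain ⟨h0, -, h2⟩ := symMat_slice s b
  rw [P_eq, h0, h2]
  push_cast
  rfl

theorem slice_analyticAt_left (b w : ℂ) (i j : Fin 2) :
    AnalyticAt ℂ (fun s => (slice s b).1 i j) w := by
  simp only [coe_slice]
  fin_cases i <;> fin_cases j <;> simp <;> fun_prop

theorem slice_analyticAt_right (s a w : ℂ) (i j : Fin 2) :
    AnalyticAt ℂ (fun t => (slice s (a * t)).1 i j) w := by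
  simp only [coe_slice]
  fin_cases i <;> fin_cases j <;> simp <;> fun_prop

theorem slice_add (s s' : ℝ) (b : ℂ) : (slice (s + s' : ℝ) b : XC) =
    toC (diagR (Real.exp s) (Real.exp_pos s).ne') • (slice s' b : XC) := by
  have : expA (s + s' : ℝ) = expA s * expA s' := by
    ext i j
    rw [Matrix.SpecialLinearGroup.coe_mul, coe_expA', coe_expA', coe_expA']
    fin_cases i <;> fin_cases j <;> simp [Matrix.mul_apply, Fin.sum_univ_two, Complex.exp_add]
    all_goals ring
  rw [toC_diagR_exp, smul_mk, slice, slice, this, mul_assoc]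

theorem slice_mem_crown (s : ℝ) {b : ℝ} (hb : b ^ 2 < 1) : (slice s b : XC) ∈ crown := by
  obtain ⟨h0, h1, h2⟩ := symMat_slice s b
  have e0 : symMat (slice s b : XC) 0 0 = (Real.exp (2 * s) : ℝ) := by rw [h0]; push_cast; rfl
  have e2 : symMat (slice s b : XC) 1 1 = (Real.exp (-(2 * s)) * (1 - b ^ 2) : ℝ) := by
    rw [h2]; push_cast; rfl
  rw [mem_crown_iff, e0, h1, e2, Complex.ofReal_re, Complex.ofReal_re]
  have hpos : 0 < Real.exp (-(2 * s)) * (1 - b ^ 2) :=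
    mul_pos (Real.exp_pos _) (by linarith)
  refine ⟨hpos, ?_⟩
  have : (Complex.I * b).re = 0 := by simp
  rw [this]
  have := mul_pos (Real.exp_pos (2 * s)) hpos
  simpa using this

/-- The real lower triangular unipotent matrices. -/
def lowR (x : ℝ) : SL(2, ℝ) := ⟨!![1, 0; x, 1], by simp [Matrix.det_fin_two_of]⟩

theorem toC_lowR (x : ℝ) : toC (lowR x) = lowC x := by
  ext i j
  rw [toC_apply]
  fin_cases i <;> fin_cases j <;> simp [lowR, lowC]

theorem slice_mem_realX (s β : ℝ) : (slice s (Complex.I * β) : XC) ∈ realX := by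
  refine ⟨diagR (Real.exp s) (Real.exp_pos s).ne' * lowR (-β), ?_⟩
  have : Complex.I * (Complex.I * β) = ((-β : ℝ) : ℂ) := by
    rw [← mul_assoc, Complex.I_mul_I]; push_cast; ring
  simp only [map_mul, toC_diagR_exp, toC_lowR, basePt, smul_mk, mul_one, slice, this]

/-- A holomorphic extension of a spherical function cannot be defined on a `G`-domain which
contains a generic boundary point of the crown. -/
theorem false_of_slice_mem {lam : ℂ} (hlam : lam.re = 0) {U : Set XC} (hU : IsGDomain U)
    (hcU : crown ⊆ U) {F : XC → ℂ} (hF : HolomorphicOn F U) (hEq : EqOn F (spherical lam) realX)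
    {η : ℝ} (hη : η ^ 2 = 1) {s₁ : ℝ} (h₁ : (slice s₁ η : XC) ∈ U) : False := by
  have hmove : ∀ s s' : ℝ, ∀ b : ℂ, (slice s b : XC) ∈ U → (slice s' b : XC) ∈ U := by
    intro s s' b h
    have := slice_add (s' - s) s b
    rw [sub_add_cancel] at this
    rw [this]
    exact hU.invariant _ _ h
  obtain ⟨δ, hδ, hball⟩ : ∃ δ > 0, ∀ t : ℝ, |t - 1| ≤ δ → ∀ s : ℝ,
      (slice s (η * t : ℝ) : XC) ∈ U := by
    have hcont : Continuous fun t : ℝ => (slice 0 (η * t : ℝ) : XC) := by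
      refine QuotientGroup.continuous_mk.comp (Continuous.subtype_mk ?_ _)
      have : ∀ t : ℝ, (slice 0 (η * t : ℝ)).1 = !![1, 0; Complex.I * (η * t : ℝ), 1] := by
        intro t; rw [coe_slice]; simp
      refine (continuous_congr this).2 (continuous_matrix fun i j => ?_)
      fin_cases i <;> fin_cases j <;> simp <;> fun_prop
    have hnhds : ∀ᶠ t : ℝ in 𝓝 1, (slice 0 (η * t : ℝ) : XC) ∈ U :=
      hcont.continuousAt.eventually (hU.isOpen.mem_nhds (by
        simpa using hmove s₁ 0 η h₁))
    obtain ⟨ε, hε, h⟩ := Metric.eventually_nhds_iff.1 hnhds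
    refine ⟨ε / 2, half_pos hε, fun t ht s => ?_⟩
    have h0 := h (y := t) (by rw [Real.dist_eq]; linarith)
    have := hmove 0 s (η * t : ℝ) (by simpa using h0)
    exact this
  set T := 1 + δ with hT
  have hmem : ∀ t ∈ Icc 0 T, ∀ s : ℝ, (slice s (η * t : ℝ) : XC) ∈ U := by
    intro t ht s
    by_cases h : t < 1
    · refine hcU (slice_mem_crown s ?_)
      rw [mul_pow, hη, one_mul]
      nlinarith [ht.1]
    · exact hball t (by rw [abs_le]; constructor <;> linarith [ht.2, not_lt.1 h]) s
  have hmulT : ∀ t : ℝ, ((η : ℂ) * (t : ℂ)) = ((η * t : ℝ) : ℂ) := fun t => by push_cast; rfl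
  have hval : ∀ s : ℝ, δ < Real.exp (2 * s) → F (slice s (η * T : ℝ) : XC) =
      conical lam (((Real.exp (2 * s) + Real.exp (-(2 * s)) * (1 - T ^ 2)) / 2 : ℝ) : ℂ) := by
    intro s hs
    have hI : uIcc 0 T = Icc 0 T := uIcc_of_le (by linarith)
    have key := eq_conical_of_segment hlam hF (h := fun t => slice s (η * t)) (T := T)
      (fun w i j => slice_analyticAt_right _ _ _ _ _) ?_ ?_ ?_
    · simp only [hmulT] at key
      rw [key, P_slice, mul_pow, hη, one_mul]
      push_cast
      rfl
    · intro t ht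
      rw [hI] at ht
      simp only [hmulT]
      exact hmem t ht s
    · intro t ht
      rw [hI] at ht
      simp only [hmulT]
      refine mem_XHat_of_P_eq (P_slice _ _) ?_
      rw [mul_pow, hη, one_mul, Real.exp_neg]
      have he := Real.exp_pos (2 * s)
      have h2 : t ^ 2 < (Real.exp (2 * s) + 1) ^ 2 := by nlinarith [ht.1, ht.2]
      have h3 : Real.exp (2 * s) + (Real.exp (2 * s))⁻¹ * (1 - t ^ 2) + 2 =
          ((Real.exp (2 * s) + 1) ^ 2 - t ^ 2) / Real.exp (2 * s) := by
        field_simp; ring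
      have h4 : 0 < ((Real.exp (2 * s) + 1) ^ 2 - t ^ 2) / Real.exp (2 * s) :=
        div_pos (by linarith) he
      linarith
    · have hlim : Tendsto (fun β : ℝ => Complex.I * ((β / η : ℝ) : ℂ)) (𝓝[≠] 0) (𝓝[≠] 0) := by
        have hη0 : η ≠ 0 := by rintro rfl; norm_num at hη
        refine tendsto_nhdsWithin_iff.2 ⟨?_, ?_⟩
        · have : Continuous fun β : ℝ => Complex.I * ((β / η : ℝ) : ℂ) := by fun_prop
          exact (this.tendsto' 0 0 (by simp)).mono_left nhdsWithin_le_nhds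
        · filter_upwards [self_mem_nhdsWithin] with β hβ
          have : β ≠ 0 := hβ
          simp [this, hη0]
      refine hlim.frequently (Eventually.frequently (Eventually.of_forall fun β => ?_))
      have hmem := slice_mem_realX s (η * (β / η))
      have : (η : ℂ) * (Complex.I * ((β / η : ℝ) : ℂ)) = Complex.I * ((η * (β / η) : ℝ) : ℂ) := by
        push_cast; ring
      rw [this, hEq hmem, spherical_eq_conical hlam (realX_subset_crown hmem)]
  set s₀ := Real.log δ / 2 with hs₀
  have hes₀ : Real.exp (2 * s₀) = δ := by
    rw [hs₀, mul_div_cancel₀ _ two_ne_zero, Real.exp_log hδ]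
  have hcF : Tendsto (fun s : ℝ => (F (slice s (η * T : ℝ) : XC)).re) (𝓝[>] s₀)
      (𝓝 (F (slice s₀ (η * T : ℝ) : XC)).re) := by
    have h1 := (hF.analyticAt_comp (h := fun s => slice s (η * T : ℝ)) (w := s₀)
      (fun i j => slice_analyticAt_left _ _ _ _) (hmem T ⟨by linarith, le_rfl⟩ s₀)).continuousAt
    have h2 : ContinuousAt (fun s : ℝ => (F (slice s (η * T : ℝ) : XC)).re) s₀ :=
      Complex.continuous_re.continuousAt.comp
        (ContinuousAt.comp (f := fun s : ℝ => (s : ℂ)) h1 Complex.continuous_ofReal.continuousAt)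
    exact h2.tendsto.mono_left nhdsWithin_le_nhds
  have hcC : Tendsto (fun s : ℝ => (Real.exp (2 * s) + Real.exp (-(2 * s)) * (1 - T ^ 2)) / 2)
      (𝓝[>] s₀) (𝓝[>] (-1)) := by
    refine tendsto_nhdsWithin_iff.2 ⟨?_, ?_⟩
    · have : Continuous fun s : ℝ =>
          (Real.exp (2 * s) + Real.exp (-(2 * s)) * (1 - T ^ 2)) / 2 := by fun_prop
      refine (this.tendsto' s₀ (-1) ?_).mono_left nhdsWithin_le_nhds
      rw [Real.exp_neg, hes₀, hT]
      field_simp; ring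
    · filter_upwards [self_mem_nhdsWithin] with s hs
      have hs' : s₀ < s := hs
      have he : δ < Real.exp (2 * s) := by
        rw [← hes₀]; exact Real.exp_lt_exp.2 (by linarith)
      have h3 : (Real.exp (2 * s) + (Real.exp (2 * s))⁻¹ * (1 - T ^ 2)) / 2 + 1 =
          ((Real.exp (2 * s) + 1) ^ 2 - T ^ 2) / Real.exp (2 * s) / 2 := by
        have := Real.exp_pos (2 * s)
        field_simp; ring
      have h4 : 0 < ((Real.exp (2 * s) + 1) ^ 2 - T ^ 2) / Real.exp (2 * s) / 2 := by
        refine div_pos (div_pos ?_ (Real.exp_pos _)) two_pos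
        rw [hT]; nlinarith
      rw [Real.exp_neg]
      have : -1 < (Real.exp (2 * s) + (Real.exp (2 * s))⁻¹ * (1 - T ^ 2)) / 2 := by linarith
      exact this
  have hinf := (tendsto_conical_atTop hlam).comp hcC
  refine not_tendsto_nhds_of_tendsto_atTop hinf _ (hcF.congr' ?_)
  filter_upwards [self_mem_nhdsWithin] with s hs
  have hs' : s₀ < s := hs
  rw [hval s (by rw [← hes₀]; exact Real.exp_lt_exp.2 (by linarith))]
  rfl

/-- The real matrix with bottom row `(1, x)`. -/
def flipR (x : ℝ) : SL(2, ℝ) := ⟨!![0, -1; 1, x], by simp [Matrix.det_fin_two_of]⟩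

theorem symMat_flipR (x : ℝ) (z : XC) :
    symMat (toC (flipR x) • z) 0 0 = symMat z 1 1 ∧
    symMat (toC (flipR x) • z) 0 1 = -(symMat z 0 1 + x * symMat z 1 1) ∧
    symMat (toC (flipR x) • z) 1 1 =
      symMat z 0 0 + 2 * x * symMat z 0 1 + x ^ 2 * symMat z 1 1 := by
  refine ⟨?_, ?_, ?_⟩ <;> rw [symMat_toC_smul_apply] <;> simp [flipR]
  all_goals ring

/-- A boundary point of the crown can be moved by `G` so that its symmetric matrix has a vanishing
lower right entry. -/
theorem exists_toC_smul_eq_zero {z : XC} (h00 : 0 ≤ (symMat z 0 0).re)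
    (h11 : 0 ≤ (symMat z 1 1).re)
    (hdet : (symMat z 0 1).re ^ 2 = (symMat z 0 0).re * (symMat z 1 1).re) :
    ∃ g : SL(2, ℝ), symMat (toC g • z) 1 1 = 0 ∧ 0 ≤ (symMat (toC g • z) 0 0).re := by
  have base : ∀ w : XC, 0 < (symMat w 0 0).re → (symMat w 0 1).re = 0 → (symMat w 1 1).re = 0 →
      symMat w 1 1 = 0 := by
    intro w h0 h1 h2
    have him := congrArg Complex.im (symMat_det w)
    simp only [pow_two, Complex.sub_im, Complex.mul_im, h1, h2, Complex.one_im] at him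
    have : (symMat w 0 0).re * (symMat w 1 1).im = 0 := by linear_combination him
    rcases mul_eq_zero.1 this with h | h
    · exact absurd h h0.ne'
    · exact Complex.ext h2 h
  rcases h11.lt_or_eq with hpos | hzero
  · set x := -(symMat z 0 1).re / (symMat z 1 1).re with hx
    obtain ⟨f0, f1, f2⟩ := symMat_flipR x z
    have hcast : (x : ℂ) ^ 2 = ((x ^ 2 : ℝ) : ℂ) := by push_cast; rfl
    have hcast2 : (2 : ℂ) * (x : ℂ) = ((2 * x : ℝ) : ℂ) := by push_cast; rfl
    refine ⟨flipR x, base _ ?_ ?_ ?_, ?_⟩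
    · rw [f0]; exact hpos
    · rw [f1, Complex.neg_re, Complex.add_re, Complex.re_ofReal_mul, hx]; field_simp; ring
    · rw [f2, hcast, hcast2]
      simp only [Complex.add_re, Complex.re_ofReal_mul]
      rw [hx]
      field_simp
      linear_combination -hdet
    · rw [f0]; exact hpos.le
  · rw [← hzero, mul_zero] at hdet
    have h01 : (symMat z 0 1).re = 0 := pow_eq_zero_iff two_ne_zero |>.1 hdet
    rcases h00.lt_or_eq with hpos | hzero0
    · exact ⟨1, by simpa using base z hpos h01 hzero.symm, by simpa using h00⟩
    · by_cases hm : symMat z 1 1 = 0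
      · exact ⟨1, by simpa using hm, by simpa using h00⟩
      · have hre := congrArg Complex.re (symMat_det z)
        simp only [pow_two, Complex.sub_re, Complex.mul_re, h01, ← hzero, ← hzero0,
          Complex.one_re] at hre
        have hm2 : (symMat z 1 1).im ≠ 0 := fun h => hm (Complex.ext hzero.symm h)
        set x := (-(symMat z 0 1).im + 1) / (symMat z 1 1).im with hx
        obtain ⟨f0, f1, f2⟩ := symMat_flipR x z
        have hcast : (x : ℂ) ^ 2 = ((x ^ 2 : ℝ) : ℂ) := by push_cast; rfl
        have hcast2 : (2 : ℂ) * (x : ℂ) = ((2 * x : ℝ) : ℂ) := by push_cast; rfl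
        refine ⟨flipR x, ?_, ?_⟩
        · rw [f2, hcast, hcast2]
          refine Complex.ext ?_ ?_
          · simp only [Complex.add_re, Complex.re_ofReal_mul, h01, ← hzero, ← hzero0]
            simp
          · simp only [Complex.add_im, Complex.im_ofReal_mul, Complex.zero_im]
            rw [hx]
            field_simp
            linear_combination -hre
        · rw [f0]; exact h11

/-- A `G`-domain containing the crown strictly contains a generic boundary point. -/
theorem exists_slice_mem {U : Set XC} (hU : IsGDomain U) (hcU : crown ⊆ U) (hne : ¬ U ⊆ crown) :
    ∃ s η : ℝ, η ^ 2 = 1 ∧ (slice s η : XC) ∈ U := by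
  obtain ⟨z, hzU, hzc, hzn⟩ : ∃ z ∈ U, z ∈ closure crown ∧ z ∉ crown := by
    by_contra! hcon
    refine hne (hU.isConnected.isPreconnected.subset_left_of_subset_union
      (v := (closure crown)ᶜ) isOpen_crown isClosed_closure.isOpen_compl ?_ ?_ ?_)
    · exact disjoint_compl_right.mono_left subset_closure
    · intro z hz
      by_cases h : z ∈ closure crown
      · exact Or.inl (hcon z hz h)
      · exact Or.inr h
    · obtain ⟨z, hz⟩ := isConnected_crown.nonempty
      exact ⟨z, hcU hz, hz⟩
  have hent : ∀ i j, Continuous fun z : XC => (symMat z i j).re := fun i j =>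
    Complex.continuous_re.comp (continuous_symMat.matrix_elem i j)
  have hcl : z ∈ {z : XC | 0 ≤ (symMat z 0 0).re} ∩ {z | 0 ≤ (symMat z 1 1).re} ∩
      {z | (symMat z 0 1).re ^ 2 ≤ (symMat z 0 0).re * (symMat z 1 1).re} := by
    refine closure_minimal ?_ (((isClosed_le continuous_const (hent 0 0)).inter
      (isClosed_le continuous_const (hent 1 1))).inter
      (isClosed_le ((hent 0 1).pow 2) ((hent 0 0).mul (hent 1 1)))) hzc
    intro w hw
    obtain ⟨h1, h2⟩ := mem_crown_iff.1 hw
    refine ⟨⟨?_, h1.le⟩, h2.le⟩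
    have : 0 < (symMat w 0 0).re := by
      by_contra h
      nlinarith [sq_nonneg (symMat w 0 1).re]
    exact this.le
  obtain ⟨⟨h00, h11⟩, hdet⟩ := hcl
  have h00 : 0 ≤ (symMat z 0 0).re := h00
  have h11 : 0 ≤ (symMat z 1 1).re := h11
  have hdet : (symMat z 0 1).re ^ 2 ≤ (symMat z 0 0).re * (symMat z 1 1).re := hdet
  have hdet' : (symMat z 0 1).re ^ 2 = (symMat z 0 0).re * (symMat z 1 1).re := by
    refine le_antisymm hdet (not_lt.1 fun hlt => ?_)
    rcases h11.lt_or_eq with h | h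
    · exact hzn (mem_crown_iff.2 ⟨h, hlt⟩)
    · rw [← h, mul_zero] at hlt
      nlinarith [sq_nonneg (symMat z 0 1).re]
  obtain ⟨g, hg11, hg00⟩ := exists_toC_smul_eq_zero h00 h11 hdet'
  have hwU := hU.invariant g z hzU
  set w := toC g • z with hw
  have hdw := symMat_det w
  rw [hg11, mul_zero, zero_sub] at hdw
  obtain ⟨η, hη, hη01⟩ : ∃ η : ℝ, η ^ 2 = 1 ∧ symMat w 0 1 = Complex.I * η := by
    have h1 : symMat w 0 1 ^ 2 = Complex.I ^ 2 := by
      rw [Complex.I_sq]; linear_combination -hdw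
    rcases sq_eq_sq_iff_eq_or_eq_neg.1 h1 with h | h
    · exact ⟨1, by norm_num, by rw [h]; simp⟩
    · exact ⟨-1, by norm_num, by rw [h]; simp⟩
  have hηC : (η : ℂ) ^ 2 = 1 := by exact_mod_cast hη
  set v := toC (unipR (-(η * (symMat w 0 0).im) / 2)) • w with hv
  have hvU : v ∈ U := hU.invariant _ w hwU
  obtain ⟨u0, u1, u2⟩ := symMat_unipR (-(η * (symMat w 0 0).im) / 2) w
  rw [hη01, hg11] at u0 u1
  rw [hg11] at u2
  have v00 : symMat v 0 0 = (symMat w 0 0).re := by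
    rw [hv, u0]
    push_cast
    linear_combination (-Complex.I * (symMat w 0 0).im) * hηC - Complex.re_add_im (symMat w 0 0)
  have hcont : Continuous fun ε : ℝ => unip (-(Complex.I * η * ε) / 2) • v := by
    obtain ⟨h, hh⟩ := QuotientGroup.mk_surjective v
    rw [← hh]
    simp only [smul_mk]
    exact QuotientGroup.continuous_mk.comp
      ((continuous_unip.comp (by fun_prop)).mul continuous_const)
  have hunip0 : unip 0 = 1 := by
    ext i j; rw [coe_unip]; fin_cases i <;> fin_cases j <;> simp
  have hev : ∀ᶠ ε : ℝ in 𝓝 0, unip (-(Complex.I * η * ε) / 2) • v ∈ U :=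
    hcont.continuousAt.eventually (hU.isOpen.mem_nhds (by simpa [hunip0] using hvU))
  obtain ⟨ε₀, hε₀, hε⟩ := Metric.eventually_nhds_iff.1 hev
  have hεU := hε (y := ε₀ / 2) (by
    rw [Real.dist_eq, sub_zero, abs_of_pos (half_pos hε₀)]; linarith)
  set p := (symMat w 0 0).re + ε₀ / 2 with hp
  have hp0 : 0 < p := by linarith
  refine ⟨Real.log p / 2, η, hη, ?_⟩
  convert hεU using 1
  obtain ⟨t0, t1, t2⟩ := symMat_slice (Real.log p / 2 : ℝ) η
  obtain ⟨q0, q1, q2⟩ := symMat_unip (-(Complex.I * η * (ε₀ / 2 : ℝ)) / 2) v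
  rw [u1, u2, v00] at q0
  rw [u1, u2] at q1
  rw [u2] at q2
  have hexp : Complex.exp (2 * (Real.log p / 2 : ℝ)) = p := by
    have : (2 : ℂ) * (Real.log p / 2 : ℝ) = (Real.log p : ℝ) := by push_cast; ring
    rw [this, ← Complex.ofReal_exp, Real.exp_log hp0]
  refine symMat_ext ?_ ?_ ?_
  · rw [t0, q0, hexp, hp]
    push_cast
    linear_combination (η ^ 2 * (ε₀ / 2)) * Complex.I_sq - (ε₀ / 2 : ℂ) * hηC
  · rw [t1, q1]; ring
  · rw [t2, q2, hηC]; ring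

theorem maximal_crown {lam : ℂ} (hlam : lam.re = 0) : Maximal (IsExtensionDomain lam) crown := by
  refine ⟨⟨isGDomain_crown, realX_subset_crown, spherical lam, holomorphicOn_spherical hlam,
    fun _ _ => rfl⟩, ?_⟩
  rintro U ⟨hU, -, F, hF, hEq⟩ hcU
  by_contra hne
  obtain ⟨s, η, hη, hs⟩ := exists_slice_mem hU hcU hne
  exact false_of_slice_mem hlam hU hcU hF hEq hη hs

/-- The hyperbolic rotation by `u`. -/
noncomputable def hypR (u : ℝ) : SL(2, ℝ) :=
  ⟨!![Real.cosh u, Real.sinh u; Real.sinh u, Real.cosh u], by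
    rw [Matrix.det_fin_two_of]; nlinarith [Real.cosh_sq u]⟩

theorem continuous_hypR : Continuous hypR := by
  refine Continuous.subtype_mk (continuous_matrix fun i j => ?_) _
  fin_cases i <;> fin_cases j <;> simp <;> fun_prop

theorem hypR_zero : hypR 0 = 1 := by
  ext i j
  fin_cases i <;> fin_cases j <;> simp [hypR]

theorem P_hypR_expI (u y : ℝ) :
    P (toC (hypR u) • expI y) = ((2 * (Real.cosh (2 * u) * Real.cos (2 * y)) : ℝ) : ℂ) := by
  obtain ⟨h0, h1, h2⟩ := symMat_expI y
  rw [P_eq, symMat_toC_smul_apply, symMat_toC_smul_apply, h0, h1, h2, Real.cosh_two_mul]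
  simp only [hypR, Matrix.of_apply, Matrix.cons_val_zero, Matrix.cons_val_one, Matrix.cons_val']
  push_cast
  ring

theorem continuation_hypR_expI {lam : ℂ} (hlam : lam.re = 0) {ψ : XC → ℂ}
    (hψ : HolomorphicOn ψ XHat) (hEq : EqOn ψ (spherical lam) crown) {u y : ℝ}
    (hy : |y| < Real.pi / 2) (hc : -1 < Real.cosh (2 * u) * Real.cos (2 * y)) :
    ψ (toC (hypR u) • expI y) = conical lam ((Real.cosh (2 * u) * Real.cos (2 * y) : ℝ) : ℂ) := by
  have hmk : ∀ t : ℝ, ((toC (hypR u) * expA (t * Complex.I) : SL(2, ℂ)) : XC) =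
      toC (hypR u) • expI t := by
    intro t; rw [expI, basePt, smul_mk, smul_mk, mul_one]
  have hX : ∀ t ∈ uIcc 0 y,
      ((toC (hypR u) * expA (t * Complex.I) : SL(2, ℂ)) : XC) ∈ XHat := by
    intro t ht
    rw [hmk]
    refine mem_XHat_of_P_eq (P_hypR_expI _ _) ?_
    have habs : |t| ≤ |y| := by
      have := abs_sub_left_of_mem_uIcc ht
      simpa using this
    have hcos : Real.cos (2 * y) ≤ Real.cos (2 * t) := by
      rw [← Real.cos_abs (2 * y), ← Real.cos_abs (2 * t), abs_mul, abs_mul, abs_two]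
      exact Real.cos_le_cos_of_nonneg_of_le_pi (by positivity) (by linarith) (by linarith)
    have := mul_le_mul_of_nonneg_left hcos (Real.cosh_pos (2 * u)).le
    linarith
  have key := eq_conical_of_segment hlam hψ
    (h := fun w => toC (hypR u) * expA (w * Complex.I)) (T := y) ?_ hX hX ?_
  · rw [hmk, P_hypR_expI] at key
    rw [key]
    push_cast
    congr 1
    ring
  · intro w i j
    simp only [Matrix.SpecialLinearGroup.coe_mul, coe_expA', Matrix.mul_apply, Fin.sum_univ_two]
    fin_cases j <;> simp <;> fun_prop
  · have hlim : Tendsto (fun t : ℝ => (t : ℂ)) (𝓝[≠] 0) (𝓝[≠] 0) := by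
      refine tendsto_nhdsWithin_iff.2 ⟨?_, ?_⟩
      · exact (Complex.continuous_ofReal.tendsto' 0 0 (by simp)).mono_left nhdsWithin_le_nhds
      · filter_upwards [self_mem_nhdsWithin] with x hx
        simpa using hx
    refine hlim.frequently (Eventually.frequently ?_)
    have hΩ : ∀ᶠ t : ℝ in 𝓝[≠] 0, t ∈ Omega :=
      mem_nhdsWithin_of_mem_nhds (isOpen_Ioo.mem_nhds zero_mem_Omega)
    filter_upwards [hΩ] with t ht
    have hmem : toC (hypR u) • expI t ∈ crown := ⟨hypR u, t, ht, rfl⟩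
    rw [hmk, hEq hmem, spherical_eq_conical hlam hmem]

theorem mem_twoOmega_diff {y : ℝ} (hy : y ∈ twoOmega \ closure Omega) :
    |y| < Real.pi / 2 ∧ Real.pi / 4 < |y| := by
  obtain ⟨⟨x, hx, rfl⟩, hn⟩ := hy
  have hx1 := hx.1
  have hx2 := hx.2
  refine ⟨by rw [abs_lt]; constructor <;> simp only <;> linarith, ?_⟩
  rw [Omega, closure_Ioo (by linarith [Real.pi_pos])] at hn
  by_contra h
  rw [not_lt, abs_le] at h
  exact hn h

theorem blowup_curve {y : ℝ} (hy : y ∈ twoOmega \ closure Omega) :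
    ∃ (γ : ℝ → SL(2, ℝ)) (σ : ℝ → ℝ),
      ContinuousOn γ (Icc 0 1) ∧ γ 0 = 1 ∧
      (∀ s ∈ Icc (0 : ℝ) 1, P (toC (γ s) • expI y) = (σ s : ℂ)) ∧
      StrictAntiOn σ (Icc 0 1) ∧
      σ 0 = 2 * Real.cos (2 * y) ∧ σ 1 = -2 ∧
      ∀ lam : ℂ, lam.re = 0 →
        ∀ ψ : XC → ℂ, HolomorphicOn ψ XHat → EqOn ψ (spherical lam) crown →
          (∀ s ∈ Ico (0 : ℝ) 1,
            0 < (ψ (toC (γ s) • expI y)).re ∧ (ψ (toC (γ s) • expI y)).im = 0) ∧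
          Tendsto (fun s => (ψ (toC (γ s) • expI y)).re) (𝓝[<] 1) atTop := by
  obtain ⟨hy2, hy4⟩ := mem_twoOmega_diff hy
  have hcos_abs : Real.cos (2 * y) = Real.cos (2 * |y|) := by
    rw [← Real.cos_abs (2 * y), abs_mul, abs_two]
  have hneg : Real.cos (2 * y) < 0 := by
    rw [hcos_abs]
    exact Real.cos_neg_of_pi_div_two_lt_of_lt (by linarith) (by linarith [Real.pi_pos])
  have hgt : -1 < Real.cos (2 * y) := by
    rw [hcos_abs, ← Real.cos_pi]
    exact Real.cos_lt_cos_of_nonneg_of_le_pi (by positivity) le_rfl (by linarith)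
  set κ := Real.cos (2 * y) with hκ
  have ha : 1 < -κ⁻¹ := by
    rw [← inv_neg]; exact (one_lt_inv₀ (by linarith)).2 (by linarith)
  set T := Real.arcosh (-κ⁻¹) / 2 with hT
  have hT0 : 0 < T := half_pos (Real.arcosh_pos ha)
  have hcT : Real.cosh (2 * T) * κ = -1 := by
    rw [hT, mul_div_cancel₀ _ two_ne_zero, Real.cosh_arcosh ha.le, neg_mul, inv_mul_cancel₀ hneg.ne]
  have hmono : ∀ s ∈ Icc (0 : ℝ) 1, ∀ s' ∈ Icc (0 : ℝ) 1, s < s' →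
      Real.cosh (2 * (T * s')) * κ < Real.cosh (2 * (T * s)) * κ := by
    intro s hs s' hs' h
    refine mul_lt_mul_of_neg_right ?_ hneg
    rw [Real.cosh_lt_cosh, abs_of_nonneg (by have := hs.1; positivity),
      abs_of_nonneg (by have := hs'.1; positivity)]
    nlinarith
  have hrange : ∀ s ∈ Ico (0 : ℝ) 1, -1 < Real.cosh (2 * (T * s)) * κ ∧
      Real.cosh (2 * (T * s)) * κ ≤ 1 := by
    intro s hs
    constructor
    · have := hmono s ⟨hs.1, hs.2.le⟩ 1 (by simp) hs.2
      rwa [mul_one, hcT] at this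
    · have := mul_neg_of_pos_of_neg (Real.cosh_pos (2 * (T * s))) hneg
      linarith
  refine ⟨fun s => hypR (T * s), fun s => 2 * (Real.cosh (2 * (T * s)) * κ), ?_, ?_, ?_, ?_, ?_,
    ?_, ?_⟩
  · exact (continuous_hypR.comp (by fun_prop)).continuousOn
  · simp only [mul_zero, hypR_zero]
  · intro s _
    exact P_hypR_expI _ _
  · intro s hs s' hs' h
    have := hmono s hs s' hs' h
    simp only
    linarith
  · simp
  · simp only [mul_one]
    rw [hcT]; norm_num
  · intro lam hlam ψ hψ hEq
    have hval : ∀ s ∈ Ico (0 : ℝ) 1, ψ (toC (hypR (T * s)) • expI y) =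
        conical lam ((Real.cosh (2 * (T * s)) * κ : ℝ) : ℂ) := fun s hs =>
      continuation_hypR_expI hlam hψ hEq hy2 (hrange s hs).1
    refine ⟨fun s hs => ?_, ?_⟩
    · obtain ⟨h1, h2⟩ := hrange s hs
      obtain ⟨h3, h4, -⟩ := conical_real hlam h1 h2
      simp only [hval s hs]
      exact ⟨h3, h4⟩
    · have hIco : ∀ᶠ s : ℝ in 𝓝[<] 1, s ∈ Ico (0 : ℝ) 1 := Ico_mem_nhdsLT one_pos
      have hlim : Tendsto (fun s : ℝ => Real.cosh (2 * (T * s)) * κ) (𝓝[<] 1) (𝓝[>] (-1)) := by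
        refine tendsto_nhdsWithin_iff.2 ⟨?_, ?_⟩
        · have : Continuous fun s : ℝ => Real.cosh (2 * (T * s)) * κ := by fun_prop
          exact (this.tendsto' 1 (-1) (by rw [mul_one, hcT])).mono_left nhdsWithin_le_nhds
        · filter_upwards [hIco] with s hs using (hrange s hs).1
      refine ((tendsto_conical_atTop hlam).comp hlim).congr' ?_
      filter_upwards [hIco] with s hs
      simp only [hval s hs, Function.comp_apply]

end SL2Crown

open SL2Crown in
theorem theorem5p4 :
    -- for every `λ` in `i a^*`: the spherical function is holomorphic on the crown, and the crown
    -- is maximal among the `G`-domains to which it extends holomorphically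
    (∀ lam : ℂ, lam.re = 0 →
      HolomorphicOn (spherical lam) crown ∧ Maximal (IsExtensionDomain lam) crown) ∧
    -- the spherical function also lives on the `K_ℂ`-domain `XHat`, as a `K_ℂ`-invariant function
    crown ⊆ XHat ∧
    (∀ lam : ℂ, lam.re = 0 →
      ∃ ψ : XC → ℂ, HolomorphicOn ψ XHat ∧ Set.EqOn ψ (spherical lam) crown ∧
        ∀ k ∈ KC, ∀ z ∈ XHat, ψ (k • z) = ψ z) ∧
    -- the curve along which `P` decreases to `-2` and the spherical functions blow up
    (∀ y ∈ twoOmega \ closure Omega,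
      ∃ (γ : ℝ → SL(2, ℝ)) (σ : ℝ → ℝ),
        ContinuousOn γ (Set.Icc 0 1) ∧ γ 0 = 1 ∧
        (∀ s ∈ Set.Icc (0 : ℝ) 1, P (toC (γ s) • expI y) = (σ s : ℂ)) ∧
        StrictAntiOn σ (Set.Icc 0 1) ∧
        σ 0 = 2 * Real.cos (2 * y) ∧ σ 1 = -2 ∧
        ∀ lam : ℂ, lam.re = 0 →
          ∀ ψ : XC → ℂ, HolomorphicOn ψ XHat → Set.EqOn ψ (spherical lam) crown →
            (∀ s ∈ Set.Ico (0 : ℝ) 1,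
              0 < (ψ (toC (γ s) • expI y)).re ∧ (ψ (toC (γ s) • expI y)).im = 0) ∧
            Filter.Tendsto (fun s => (ψ (toC (γ s) • expI y)).re) (𝓝[<] 1) Filter.atTop) := by
  exact ⟨fun _ hlam => ⟨holomorphicOn_spherical hlam, maximal_crown hlam⟩, crown_subset_XHat,
    fun lam hlam => ⟨fun z => conical lam (P z / 2), holomorphicOn_conical hlam,
      fun _ hz => (spherical_eq_conical hlam hz).symm,
      fun k hk z _ => by simp only [P_KC_smul hk]⟩,
    fun _ hy => blowup_curve hy⟩
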